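/- Let $\Bbbk$ be a field of characteristic different from $2$ and let $\mathcal{Q}\mathit{Sym}$ be the graded Hopf algebra of quasi-symmetric functions over $\Bbbk$ in the variables $x_0,x_1,x_2,\ldots$. For a composition $\alpha=(a_1,\ldots,a_k)$ of $n\ge 0$ let $M_\alpha=\sum_{i_1<\cdots<i_k}x_{i_1}^{a_1}\cdots x_{i_k}^{a_k}$ be the monomial and $F_\alpha=\sum_{\beta}M_\beta$ (sum over all compositions $\beta$ of $n$ refining $\alpha$) the fundamental quasi-symmetric function; the coproduct is $\Delta(M_\alpha)=\sum_{i=0}^k M_{(a_1,\ldots,a_i)}\otimes M_{(a_{i+1},\ldots,a_k)}$. Linear functionals on $\mathcal{Q}\mathit{Sym}$ are multiplied by convolution, with unit the counit $\epsilon$. For a linear functional $\varphi$ let $\bar\varphi(h)=(-1)^n\varphi(h)$ for $h$ homogeneous of degree $n$; $\varphi$ is even if $\bar\varphi=\varphi$, and odd if it is invertible with $\bar\varphi=\varphi^{-1}$. Let $\zeta:\mathcal{Q}\mathit{Sym}\to\Bbbk$ be the universal character, which specializes one variable to $1$ and all other variables to $0$. There is a unique pair $(\zeta_+,\zeta_-)$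 of linear functionals on $\mathcal{Q}\mathit{Sym}$ such that $\zeta_+$ is even, $\zeta_-$ is odd, $\zeta_+(1)=\zeta_-(1)=1$ and $\zeta=\zeta_+\zeta_-$. Put \[C(m,n)=\frac{(2m)!\,(2n)!}{m!\,(m+n)!\,n!},\] which is an integer for all integers $m,n\ge 0$, and, for a composition $\alpha=(a_1,\ldots,a_k)$ of a non-negative integer $n$, \[p_-(\alpha)=\#\{i\ne k: a_i>1\},\qquad p_+(\alpha)=\begin{cases}1+\#\{i\ne 1,k: a_i>1\}&\text{if }k>1,\\ 0&\text{if }k\le 1.\end{cases}\] Then, for every $n\ge 0$ and every composition $\alpha$ of $n$, $p_-(\alpha)\le\lfloor n/2\rfloor$ and \[\zeta_-(F_\alpha)=\frac{(-1)^{p_-(\alpha)}}{2^{2\lfloor n/2\rfloor}}\,C\bigl(p_-(\alpha),\lfloor n/2\rfloor-p_-(\alpha)\bigr);\] if $n$ is even, then $p_+(\alpha)\le n/2$ and \[\zeta_+(F_\alpha)=\frac{(-1)^{p_+(\alpha)}}{2^{n}}\,C\bigl(p_+(\alpha),n/2-p_+(\alpha)\bigr);\] if $n$ is odd, then $\zeta_+(F_\alpha)=0$.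 -/

import Mathlib

open scoped TensorProduct

noncomputable section

/-! ### The algebra of quasi-symmetric functions -/

/-- The sequence of nonzero exponents of a monomial in the variables `x₀, x₁, x₂, …`, read in
increasing order of the variables. -/
def exponentList (m : ℕ →₀ ℕ) : List ℕ :=
  (m.support.sort (· ≤ ·)).map m

/-- A power series in `x₀, x₁, …` is quasi-symmetric if it has bounded degree and, for all
exponents `a₁, …, aₖ` and all indices `i₁ < ⋯ < iₖ` and `j₁ < ⋯ < jₖ`, the coefficients of
`x_{i₁}^{a₁} ⋯ x_{iₖ}^{aₖ}` and of `x_{j₁}^{a₁} ⋯ x_{jₖ}^{aₖ}` coincide. -/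
def IsQuasiSymmetric {𝕜 : Type*} [Field 𝕜] (f : MvPowerSeries ℕ 𝕜) : Prop :=
  (∃ N : ℕ, ∀ m : ℕ →₀ ℕ, N < m.degree → MvPowerSeries.coeff m f = 0) ∧
  ∀ (k : ℕ) (a : Fin k →₀ ℕ) (i j : Fin k ↪o ℕ),
    MvPowerSeries.coeff (a.mapDomain i) f = MvPowerSeries.coeff (a.mapDomain j) f

theorem coeff_mapDomain_mul {𝕜 : Type*} [Field 𝕜] (f g : MvPowerSeries ℕ 𝕜) {k : ℕ}
    (a : Fin k →₀ ℕ) (i : Fin k ↪o ℕ) :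
    MvPowerSeries.coeff (a.mapDomain i) (f * g) =
      ∑ p ∈ Finset.HasAntidiagonal.antidiagonal a, MvPowerSeries.coeff (p.1.mapDomain i) f *
        MvPowerSeries.coeff (p.2.mapDomain i) g := by
  classical
  rw [MvPowerSeries.coeff_mul]
  symm
  refine Finset.sum_bij (fun p _ => (p.1.mapDomain i, p.2.mapDomain i)) ?_ ?_ ?_ ?_
  · intro p hp
    rw [Finset.HasAntidiagonal.mem_antidiagonal] at hp ⊢
    rw [← hp, Finsupp.mapDomain_add]
  · intro p _ q _ h
    have h1 := congrArg Prod.fst h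
    have h2 := congrArg Prod.snd h
    exact Prod.ext (Finsupp.mapDomain_injective i.injective h1)
      (Finsupp.mapDomain_injective i.injective h2)
  · intro q hq
    rw [Finset.HasAntidiagonal.mem_antidiagonal] at hq
    have key : ∀ u v : ℕ →₀ ℕ, u + v = a.mapDomain i →
        (u.comapDomain i i.injective.injOn).mapDomain i = u := by
      intro u v huv
      apply Finsupp.mapDomain_comapDomain _ i.injective
      intro t ht
      by_contra hn
      have h0 : (a.mapDomain i) t = 0 := Finsupp.mapDomain_of_notMem_range a t hn
      rw [← huv] at h0
      simp at h0
      simp [h0.1] at ht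
    have k1 := key q.1 q.2 hq
    have k2 := key q.2 q.1 (by rw [add_comm]; exact hq)
    refine ⟨(q.1.comapDomain i i.injective.injOn, q.2.comapDomain i i.injective.injOn), ?_, ?_⟩
    · rw [Finset.HasAntidiagonal.mem_antidiagonal]
      apply Finsupp.mapDomain_injective i.injective
      rw [Finsupp.mapDomain_add, k1, k2, hq]
    · exact Prod.ext k1 k2
  · intro p _
    rfl

/-- The algebra of quasi-symmetric functions in the variables `x₀, x₁, …` over `𝕜`, a
subalgebra of the algebra of formal power series. -/
def QSym (𝕜 : Type*) [Field 𝕜] : Subalgebra 𝕜 (MvPowerSeries ℕ 𝕜) where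
  carrier := {f | IsQuasiSymmetric f}
  add_mem' := by
    rintro f g ⟨⟨N, hN⟩, hf⟩ ⟨⟨N', hN'⟩, hg⟩
    refine ⟨⟨max N N', fun m hm => ?_⟩, fun k a i j => ?_⟩
    · rw [map_add, hN m (lt_of_le_of_lt (le_max_left _ _) hm),
        hN' m (lt_of_le_of_lt (le_max_right _ _) hm), add_zero]
    · rw [map_add, map_add, hf k a i j, hg k a i j]
  mul_mem' := by
    classical
    rintro f g ⟨⟨N, hN⟩, hf⟩ ⟨⟨N', hN'⟩, hg⟩
    refine ⟨⟨N + N', fun m hm => ?_⟩, fun k a i j => ?_⟩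
    · rw [MvPowerSeries.coeff_mul]
      refine Finset.sum_eq_zero fun p hp => ?_
      rw [Finset.HasAntidiagonal.mem_antidiagonal] at hp
      have hd : p.1.degree + p.2.degree = m.degree := by rw [← hp, map_add]
      by_cases h : N < p.1.degree
      · rw [hN _ h, zero_mul]
      · rw [hN' _ (by omega), mul_zero]
    · rw [coeff_mapDomain_mul, coeff_mapDomain_mul]
      refine Finset.sum_congr rfl fun p _ => ?_
      rw [hf k p.1 i j, hg k p.2 i j]
  algebraMap_mem' := by
    classical
    intro r
    refine ⟨⟨0, fun m hm => ?_⟩, fun k a i j => ?_⟩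
    · rw [MvPowerSeries.algebraMap_apply, MvPowerSeries.coeff_C, if_neg]
      rintro rfl
      simp at hm
    · have h : ∀ i : Fin k ↪o ℕ, a.mapDomain i = 0 ↔ a = 0 := fun i =>
        ⟨fun h => Finsupp.mapDomain_injective i.injective (by rw [h, Finsupp.mapDomain_zero]),
          fun h => by rw [h, Finsupp.mapDomain_zero]⟩
      rw [MvPowerSeries.algebraMap_apply, MvPowerSeries.coeff_C, MvPowerSeries.coeff_C]
      simp only [h]

/-! ### The monomial basis -/

theorem exponentList_mapDomain {k : ℕ} (a : Fin k →₀ ℕ) (i : Fin k ↪o ℕ) :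
    exponentList (a.mapDomain i) = (a.support.sort (· ≤ ·)).map a := by
  classical
  have hs : (a.mapDomain i).support = a.support.map i.toEmbedding := by
    rw [Finsupp.mapDomain_support_of_injective i.injective, Finset.map_eq_image]
    rfl
  unfold exponentList
  rw [hs, ← Finset.map_sort (r := (· ≤ ·)) (r' := (· ≤ ·)) _ _
    (fun x _ y _ => (i.le_iff_le).symm), List.map_map]
  refine List.map_congr_left fun x _ => ?_
  exact Finsupp.mapDomain_apply i.injective a x

theorem exponentList_pos (m : ℕ →₀ ℕ) : ∀ x ∈ exponentList m, 0 < x := by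
  intro x hx
  simp only [exponentList, List.mem_map, Finset.mem_sort, Finsupp.mem_support_iff] at hx
  obtain ⟨t, ht, rfl⟩ := hx
  omega

theorem exponentList_sum (m : ℕ →₀ ℕ) : (exponentList m).sum = m.degree := by
  classical
  unfold exponentList
  rw [Finsupp.degree_apply, ← List.sum_toFinset _ (Finset.sort_nodup _ _), Finset.sort_toFinset]

open Classical in
/-- The power series `∑_{i₁ < ⋯ < iₖ} x_{i₁}^{a₁} ⋯ x_{iₖ}^{aₖ}` of a sequence
`α = (a₁, …, aₖ)` of positive integers. -/
def monomialSeries (𝕜 : Type*) [Field 𝕜] (α : List ℕ) : MvPowerSeries ℕ 𝕜 :=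
  fun m => if exponentList m = α then 1 else 0

open Classical in
theorem coeff_monomialSeries {𝕜 : Type*} [Field 𝕜] (α : List ℕ) (m : ℕ →₀ ℕ) :
    MvPowerSeries.coeff m (monomialSeries 𝕜 α) = if exponentList m = α then 1 else 0 := rfl

/-- The monomial quasi-symmetric function `M_α = ∑_{i₁ < ⋯ < iₖ} x_{i₁}^{a₁} ⋯ x_{iₖ}^{aₖ}`
of a sequence `α = (a₁, …, aₖ)` of positive integers (`α = []` gives `1`). -/
def monomialQSym (𝕜 : Type*) [Field 𝕜] (α : List ℕ) : QSym 𝕜 :=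
  ⟨monomialSeries 𝕜 α, by
    refine ⟨⟨α.sum, fun m hm => ?_⟩, fun k a i j => ?_⟩
    · rw [coeff_monomialSeries, if_neg]
      rintro rfl
      rw [exponentList_sum] at hm
      exact lt_irrefl _ hm
    · rw [coeff_monomialSeries, coeff_monomialSeries, exponentList_mapDomain,
        exponentList_mapDomain]⟩

open Classical in
theorem coeff_monomialQSym {𝕜 : Type*} [Field 𝕜] (α : List ℕ) (m : ℕ →₀ ℕ) :
    MvPowerSeries.coeff m (monomialQSym 𝕜 α : MvPowerSeries ℕ 𝕜) =
      if exponentList m = α then 1 else 0 := rfl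

open Classical in
/-- The monomial `x₀^{a₁} ⋯ x_{k-1}^{aₖ}`. -/
def initialMonomial (α : List ℕ) : ℕ →₀ ℕ := α.toFinsupp

theorem exponentList_initialMonomial (α : List ℕ) (hα : ∀ x ∈ α, 0 < x) :
    exponentList (initialMonomial α) = α := by
  classical
  have hs : (initialMonomial α).support = Finset.range α.length := by
    unfold initialMonomial
    rw [List.toFinsupp_support, Finset.filter_true_of_mem]
    intro t ht
    rw [Finset.mem_range] at ht
    rw [List.getD_eq_getElem _ _ ht]
    exact (hα _ (List.getElem_mem ht)).ne'
  unfold exponentList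
  rw [hs, Finset.sort_range]
  refine List.ext_getElem (by simp) fun t h1 h2 => ?_
  simp [initialMonomial, List.getElem?_eq_getElem h2]

theorem coeff_eq_coeff_initialMonomial {𝕜 : Type*} [Field 𝕜] (f : QSym 𝕜) (m : ℕ →₀ ℕ) :
    MvPowerSeries.coeff m (f : MvPowerSeries ℕ 𝕜) =
      MvPowerSeries.coeff (initialMonomial (exponentList m)) (f : MvPowerSeries ℕ 𝕜) := by
  classical
  set i : Fin m.support.card ↪o ℕ := m.support.orderEmbOfFin rfl with hi
  have ha : (m.comapDomain i i.injective.injOn).mapDomain i = m := by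
    apply Finsupp.mapDomain_comapDomain _ i.injective
    rw [hi, Finset.range_orderEmbOfFin]
  have hb : (m.comapDomain i i.injective.injOn).mapDomain (Fin.valOrderEmb m.support.card) =
      initialMonomial (exponentList m) := by
    have hlen : (exponentList m).length = m.support.card := by simp [exponentList]
    ext t
    by_cases ht : t < m.support.card
    · have := Finsupp.mapDomain_apply (Fin.valOrderEmb m.support.card).injective
        (m.comapDomain i i.injective.injOn) ⟨t, ht⟩
      have e : (Fin.valOrderEmb m.support.card) ⟨t, ht⟩ = t := rfl
      rw [e] at this
      rw [this, Finsupp.comapDomain_apply]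
      simp only [initialMonomial, List.toFinsupp_apply]
      rw [List.getD_eq_getElem _ _ (by rw [hlen]; exact ht)]
      simp [exponentList, hi, Finset.orderEmbOfFin_apply]
    · rw [Finsupp.mapDomain_of_notMem_range]
      · simp only [initialMonomial, List.toFinsupp_apply]
        rw [List.getD_eq_default _ _ (by rw [hlen]; omega)]
      · rintro ⟨s, hs⟩
        apply ht
        rw [← hs]
        exact s.2
  have := f.2.2 _ (m.comapDomain i i.injective.injOn) i (Fin.valOrderEmb m.support.card)
  rwa [ha, hb] at this

theorem composition_sigma_ext {c d : Σ n, Composition n} (h : c.2.blocks = d.2.blocks) :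
    c = d := by
  obtain ⟨n, c⟩ := c
  obtain ⟨n', d⟩ := d
  have hn : n = n' := by rw [← c.blocks_sum, ← d.blocks_sum, h]
  subst hn
  have : c = d := Composition.ext h
  rw [this]

/-- The monomial quasi-symmetric functions `M_α`, for `α` a composition of some `n`, form a
basis. -/
def monomialBasis (𝕜 : Type*) [Field 𝕜] : Module.Basis (Σ n, Composition n) 𝕜 (QSym 𝕜) :=
  Module.Basis.mk (v := fun c : Σ n, Composition n => monomialQSym 𝕜 c.2.blocks)
    (by
      classical
      rw [linearIndependent_iff']
      intro s g hg c hc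
      have h := congrArg (fun f : QSym 𝕜 => MvPowerSeries.coeff (initialMonomial c.2.blocks)
        (f : MvPowerSeries ℕ 𝕜)) hg
      simp only [AddSubmonoidClass.coe_finsetSum, map_sum, SetLike.val_smul, map_smul,
        coeff_monomialQSym, exponentList_initialMonomial _ (fun _ hx => c.2.blocks_pos hx),
        ZeroMemClass.coe_zero, map_zero, smul_eq_mul] at h
      rw [Finset.sum_eq_single c] at h
      · simpa using h
      · intro d _ hd
        rw [if_neg fun e => hd (composition_sigma_ext e).symm, mul_zero]
      · exact fun h' => absurd hc h')
    (by
      classical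
      intro f _
      obtain ⟨N, hN⟩ := f.2.1
      have hf : f = ∑ c ∈ (Finset.range (N + 1)).sigma (fun n => (Finset.univ :
          Finset (Composition n))), MvPowerSeries.coeff (initialMonomial c.2.blocks)
            (f : MvPowerSeries ℕ 𝕜) • monomialQSym 𝕜 c.2.blocks := by
        apply Subtype.ext
        ext m
        simp only [AddSubmonoidClass.coe_finsetSum, map_sum, SetLike.val_smul, map_smul,
          coeff_monomialQSym, smul_eq_mul]
        rw [coeff_eq_coeff_initialMonomial]
        let c : Σ n, Composition n :=
          ⟨m.degree, ⟨exponentList m, fun h => exponentList_pos m _ h, exponentList_sum m⟩⟩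
        rw [Finset.sum_eq_single c]
        · simp [c]
        · intro d _ hd
          rw [if_neg fun e => hd (composition_sigma_ext e.symm), mul_zero]
        · intro hc
          rw [← coeff_eq_coeff_initialMonomial, hN, zero_mul]
          by_contra hlt
          apply hc
          simp only [Finset.mem_sigma, Finset.mem_range, Finset.mem_univ, and_true, c]
          omega
      rw [hf]
      exact Submodule.sum_mem _ fun c _ => Submodule.smul_mem _ _
        (Submodule.subset_span ⟨c, rfl⟩))

theorem monomialBasis_apply {𝕜 : Type*} [Field 𝕜] (c : Σ n, Composition n) :
    monomialBasis 𝕜 c = monomialQSym 𝕜 c.2.blocks := by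
  simp [monomialBasis]

/-- Linear maps on `QSym` that agree on all `M_α` are equal. -/
theorem qsym_hom_ext {𝕜 : Type*} [Field 𝕜] {V : Type*} [AddCommMonoid V] [Module 𝕜 V]
    {f g : QSym 𝕜 →ₗ[𝕜] V}
    (h : ∀ α : List ℕ, (∀ x ∈ α, 0 < x) → f (monomialQSym 𝕜 α) = g (monomialQSym 𝕜 α)) :
    f = g :=
  (monomialBasis 𝕜).ext fun c => by
    rw [monomialBasis_apply]
    exact h _ fun _ hx => c.2.blocks_pos hx

/-! ### The coalgebra structure -/

/-- The coproduct `Δ(M_{(a₁,…,aₖ)}) = ∑_{i=0}^k M_{(a₁,…,aᵢ)} ⊗ M_{(aᵢ₊₁,…,aₖ)}`. -/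
def qsymComul (𝕜 : Type*) [Field 𝕜] : QSym 𝕜 →ₗ[𝕜] QSym 𝕜 ⊗[𝕜] QSym 𝕜 :=
  (monomialBasis 𝕜).constr 𝕜 fun c =>
    ∑ i ∈ Finset.range (c.2.length + 1),
      monomialQSym 𝕜 (c.2.blocks.take i) ⊗ₜ[𝕜] monomialQSym 𝕜 (c.2.blocks.drop i)

theorem qsymComul_monomialQSym {𝕜 : Type*} [Field 𝕜] (α : List ℕ) (hα : ∀ x ∈ α, 0 < x) :
    qsymComul 𝕜 (monomialQSym 𝕜 α) = ∑ i ∈ Finset.range (α.length + 1),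
      monomialQSym 𝕜 (α.take i) ⊗ₜ[𝕜] monomialQSym 𝕜 (α.drop i) := by
  have h := (monomialBasis 𝕜).constr_basis 𝕜 (fun c : Σ n, Composition n =>
    ∑ i ∈ Finset.range (c.2.length + 1),
      monomialQSym 𝕜 (c.2.blocks.take i) ⊗ₜ[𝕜] monomialQSym 𝕜 (c.2.blocks.drop i))
      ⟨α.sum, ⟨α, fun h => hα _ h, rfl⟩⟩
  rw [monomialBasis_apply] at h
  exact h

/-- The counit: the constant term, so `1` on `M_{()}` and `0` on all other `M_α`. -/
def qsymCounit (𝕜 : Type*) [Field 𝕜] : QSym 𝕜 →ₗ[𝕜] 𝕜 :=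
  MvPowerSeries.coeff (R := 𝕜) (0 : ℕ →₀ ℕ) ∘ₗ (QSym 𝕜).val.toLinearMap

theorem qsymCounit_monomialQSym {𝕜 : Type*} [Field 𝕜] (α : List ℕ) :
    qsymCounit 𝕜 (monomialQSym 𝕜 α) = if α.length = 0 then 1 else 0 := by
  have h : qsymCounit 𝕜 (monomialQSym 𝕜 α) =
    MvPowerSeries.coeff 0 (monomialQSym 𝕜 α : MvPowerSeries ℕ 𝕜) := rfl
  rw [h, coeff_monomialQSym]
  simp [exponentList, eq_comm]

theorem exponentList_eq_nil {m : ℕ →₀ ℕ} : exponentList m = [] ↔ m = 0 := by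
  rw [exponentList, List.map_eq_nil_iff, ← List.length_eq_zero_iff, Finset.length_sort,
    Finset.card_eq_zero, Finsupp.support_eq_empty]

theorem monomialQSym_nil {𝕜 : Type*} [Field 𝕜] : monomialQSym 𝕜 [] = 1 := by
  classical
  apply Subtype.ext
  ext m
  rw [coeff_monomialQSym]
  simp [exponentList_eq_nil, MvPowerSeries.coeff_one]

instance qsymCoalgebra (𝕜 : Type*) [Field 𝕜] : Coalgebra 𝕜 (QSym 𝕜) where
  comul := qsymComul 𝕜
  counit := qsymCounit 𝕜
  coassoc := by
    apply qsym_hom_ext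
    intro α hα
    have ht : ∀ i, ∀ x ∈ α.take i, 0 < x := fun i x hx => hα x (List.mem_of_mem_take hx)
    have hd : ∀ i, ∀ x ∈ α.drop i, 0 < x := fun i x hx => hα x (List.mem_of_mem_drop hx)
    simp only [LinearMap.comp_apply, qsymComul_monomialQSym α hα, map_sum,
      LinearMap.rTensor_tmul, LinearMap.lTensor_tmul, LinearEquiv.coe_coe]
    simp only [fun i => qsymComul_monomialQSym (𝕜 := 𝕜) _ (ht i),
      fun i => qsymComul_monomialQSym (𝕜 := 𝕜) _ (hd i), TensorProduct.sum_tmul,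
      TensorProduct.tmul_sum, map_sum, TensorProduct.assoc_tmul]
    rw [Finset.sum_sigma', Finset.sum_sigma']
    refine Finset.sum_bij' (fun p _ => ⟨p.2, p.1 - p.2⟩) (fun p _ => ⟨p.1 + p.2, p.1⟩)
      ?_ ?_ ?_ ?_ ?_
    · rintro ⟨i, j⟩ h
      simp only [Finset.mem_sigma, Finset.mem_range, List.length_take, List.length_drop] at h ⊢
      omega
    · rintro ⟨i, j⟩ h
      simp only [Finset.mem_sigma, Finset.mem_range, List.length_take, List.length_drop] at h ⊢
      omega
    · rintro ⟨i, j⟩ h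
      simp only [Finset.mem_sigma, Finset.mem_range, List.length_take] at h
      have : j + (i - j) = i := by omega
      simp [this]
    · rintro ⟨i, j⟩ h
      simp
    · rintro ⟨i, j⟩ h
      simp only [Finset.mem_sigma, Finset.mem_range, List.length_take] at h
      have h1 : min j i = j := by omega
      have h2 : j + (i - j) = i := by omega
      simp only [List.take_take, List.drop_take, List.drop_drop, h1, h2]
  rTensor_counit_comp_comul := by
    apply qsym_hom_ext
    intro α hα
    simp only [LinearMap.comp_apply, qsymComul_monomialQSym α hα, map_sum,
      LinearMap.rTensor_tmul, qsymCounit_monomialQSym, TensorProduct.mk_apply]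
    rw [Finset.sum_eq_single 0]
    · simp
    · intro i hi h0
      rw [Finset.mem_range] at hi
      rw [if_neg (by rw [List.length_take]; omega), TensorProduct.zero_tmul]
    · simp
  lTensor_counit_comp_comul := by
    apply qsym_hom_ext
    intro α hα
    simp only [LinearMap.comp_apply, qsymComul_monomialQSym α hα, map_sum,
      LinearMap.lTensor_tmul, qsymCounit_monomialQSym, TensorProduct.mk_apply,
      LinearMap.flip_apply]
    rw [Finset.sum_eq_single α.length]
    · simp
    · intro i hi h0
      rw [Finset.mem_range] at hi
      rw [if_neg (by rw [List.length_drop]; omega), TensorProduct.tmul_zero]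
    · simp

/-! ### The fundamental basis -/

/-- The monomial quasi-symmetric function `M_α` of a composition `α` of `n`. -/
def qsymM (𝕜 : Type*) [Field 𝕜] {n : ℕ} (α : Composition n) : QSym 𝕜 :=
  monomialQSym 𝕜 α.blocks

/-- The fundamental quasi-symmetric function `F_α`, the sum of the `M_β` over all refinements `β`
of `α`; the composition `β` refines `α` iff every partial sum of `α` is a partial sum of `β`. -/
def qsymF (𝕜 : Type*) [Field 𝕜] {n : ℕ} (α : Composition n) : QSym 𝕜 :=
  ∑ β : Composition n with α.boundaries ⊆ β.boundaries, qsymM 𝕜 β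

/-! ### Even and odd functionals, the universal character -/

/-- The power series obtained from `f` by multiplying its homogeneous component of degree `n` by
`(-1)ⁿ`, for all `n`. -/
def barSeries {𝕜 : Type*} [Field 𝕜] (f : MvPowerSeries ℕ 𝕜) : MvPowerSeries ℕ 𝕜 :=
  fun m => (-1) ^ m.degree * MvPowerSeries.coeff m f

theorem coeff_barSeries {𝕜 : Type*} [Field 𝕜] (f : MvPowerSeries ℕ 𝕜) (m : ℕ →₀ ℕ) :
    MvPowerSeries.coeff m (barSeries f) = (-1) ^ m.degree * MvPowerSeries.coeff m f := rfl

/-- The canonical automorphism `h ↦ h̄` of `QSym`, where `h̄ = (-1)ⁿ h` for `h` homogeneous of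
degree `n`. -/
def qsymBar (𝕜 : Type*) [Field 𝕜] : QSym 𝕜 →ₗ[𝕜] QSym 𝕜 where
  toFun f := ⟨barSeries f, by
    refine ⟨?_, fun k a i j => ?_⟩
    · obtain ⟨N, hN⟩ := f.2.1
      exact ⟨N, fun m hm => by rw [coeff_barSeries, hN m hm, mul_zero]⟩
    · rw [coeff_barSeries, coeff_barSeries, f.2.2 k a i j,
        ← exponentList_sum, ← exponentList_sum, exponentList_mapDomain, exponentList_mapDomain]⟩
  map_add' f g := by
    apply Subtype.ext
    ext m
    simp only [AddMemClass.coe_add, map_add, coeff_barSeries, mul_add]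
  map_smul' r f := by
    apply Subtype.ext
    ext m
    simp only [SetLike.val_smul, map_smul, coeff_barSeries, smul_eq_mul, RingHom.id_apply,
      mul_left_comm]

/-- A functional `φ` on `QSym` is even if `φ̄ = φ`, where `φ̄(h) = φ(h̄)`. -/
def IsEvenFunctional {𝕜 : Type*} [Field 𝕜] (φ : QSym 𝕜 →ₗ[𝕜] 𝕜) : Prop :=
  φ ∘ₗ qsymBar 𝕜 = φ

/-- A functional `φ` on `QSym` is odd if it is invertible for the convolution product, with
inverse `φ̄`. -/
def IsOddFunctional {𝕜 : Type*} [Field 𝕜] (φ : QSym 𝕜 →ₗ[𝕜] 𝕜) : Prop :=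
  WithConv.toConv φ * WithConv.toConv (φ ∘ₗ qsymBar 𝕜) = 1 ∧
  WithConv.toConv (φ ∘ₗ qsymBar 𝕜) * WithConv.toConv φ = 1

/-- `φ = ρ ψ` (convolution product) with `ρ` even, `ψ` odd and `ρ(1) = ψ(1) = 1`; that is, `ρ` is
the even part and `ψ` the odd part of `φ`. -/
structure IsEvenOddDecomposition {𝕜 : Type*} [Field 𝕜] (φ ρ ψ : QSym 𝕜 →ₗ[𝕜] 𝕜) : Prop where
  even_one : ρ 1 = 1
  odd_one : ψ 1 = 1
  even : IsEvenFunctional ρ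
  odd : IsOddFunctional ψ
  eq_conv : WithConv.toConv φ = WithConv.toConv ρ * WithConv.toConv ψ

/-- The restriction of a quasi-symmetric function to one variable, a polynomial: all variables
other than `x₀` are specialized to `0`. -/
def qsymOneVariable {𝕜 : Type*} [Field 𝕜] (f : QSym 𝕜) : Polynomial 𝕜 :=
  ∑ d ∈ Finset.range (Classical.choose f.2.1 + 1), Polynomial.monomial d
    (MvPowerSeries.coeff (Finsupp.single 0 d) (f : MvPowerSeries ℕ 𝕜))

theorem qsymOneVariable_coeff {𝕜 : Type*} [Field 𝕜] (f : QSym 𝕜) (d : ℕ) :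
    (qsymOneVariable f).coeff d =
      MvPowerSeries.coeff (Finsupp.single 0 d) (f : MvPowerSeries ℕ 𝕜) := by
  simp only [qsymOneVariable, Polynomial.finsetSum_coeff, Polynomial.coeff_monomial,
    Finset.sum_ite_eq', Finset.mem_range]
  split_ifs with h
  · rfl
  · rw [Classical.choose_spec f.2.1]
    rw [Finsupp.degree_single]
    omega

/-- The universal character `ζ` of `QSym`: specialize one variable to `1` and all other variables
to `0`. -/
def qsymZeta (𝕜 : Type*) [Field 𝕜] : QSym 𝕜 →ₐ[𝕜] 𝕜 where
  toFun f := (qsymOneVariable f).eval 1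
  map_one' := by
    classical
    have h : qsymOneVariable (1 : QSym 𝕜) = 1 := by
      ext d
      rw [qsymOneVariable_coeff]
      simp [MvPowerSeries.coeff_one, Polynomial.coeff_one]
    rw [h, Polynomial.eval_one]
  map_mul' f g := by
    classical
    have h : qsymOneVariable (f * g) = qsymOneVariable f * qsymOneVariable g := by
      ext d
      rw [qsymOneVariable_coeff, Polynomial.coeff_mul, MulMemClass.coe_mul,
        MvPowerSeries.coeff_mul, Finsupp.antidiagonal_single, Finset.sum_map]
      simp only [qsymOneVariable_coeff]
      rfl
    rw [h, Polynomial.eval_mul]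
  map_zero' := by
    have h : qsymOneVariable (0 : QSym 𝕜) = 0 := by
      ext d
      rw [qsymOneVariable_coeff]
      simp
    rw [h, Polynomial.eval_zero]
  map_add' f g := by
    have h : qsymOneVariable (f + g) = qsymOneVariable f + qsymOneVariable g := by
      ext d
      simp only [qsymOneVariable_coeff, Polynomial.coeff_add, AddMemClass.coe_add, map_add]
    rw [h, Polynomial.eval_add]
  commutes' r := by
    classical
    have h : qsymOneVariable (algebraMap 𝕜 (QSym 𝕜) r) = Polynomial.C r := by
      ext d
      rw [qsymOneVariable_coeff, Polynomial.coeff_C, Subalgebra.coe_algebraMap,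
        MvPowerSeries.algebraMap_apply, MvPowerSeries.coeff_C]
      simp
    rw [h, Polynomial.eval_C]
    rfl

/-! ### Numbers -/

/-- The bivariate Catalan number `C(m,n) = (2m)! (2n)! / (m! (m+n)! n!)`; the division is exact. -/
def bivariateCatalan (m n : ℕ) : ℕ :=
  (2 * m).factorial * (2 * n).factorial / (m.factorial * (m + n).factorial * n.factorial)

theorem bivariateCatalan_dvd (m n : ℕ) :
    m.factorial * (m + n).factorial * n.factorial ∣ (2 * m).factorial * (2 * n).factorial := by
  suffices h : ∀ n m : ℕ, ∃ c : ℤ, ((2 * m).factorial : ℤ) * (2 * n).factorial =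
      c * (m.factorial * (m + n).factorial * n.factorial) by
    obtain ⟨c, hc⟩ := h n m
    have : ((m.factorial * (m + n).factorial * n.factorial : ℕ) : ℤ) ∣
        (((2 * m).factorial * (2 * n).factorial : ℕ) : ℤ) :=
      ⟨c, by push_cast; rw [hc, mul_comm]⟩
    exact_mod_cast this
  intro n
  induction n with
  | zero =>
    intro m
    have h := Nat.choose_mul_factorial_mul_factorial (n := 2 * m) (k := m) (by omega)
    rw [show 2 * m - m = m by omega] at h
    refine ⟨((2 * m).choose m : ℤ), ?_⟩
    rw [← h]
    simp [mul_assoc]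
  | succ n ih =>
    intro m
    obtain ⟨c, hc⟩ := ih m
    obtain ⟨c', hc'⟩ := ih (m + 1)
    refine ⟨4 * c - c', ?_⟩
    have e1 : (2 * (n + 1)).factorial = (2 * n + 2) * ((2 * n + 1) * (2 * n).factorial) := by
      rw [show 2 * (n + 1) = 2 * n + 1 + 1 by ring, Nat.factorial_succ, Nat.factorial_succ]
    have e2 : (2 * (m + 1)).factorial = (2 * m + 2) * ((2 * m + 1) * (2 * m).factorial) := by
      rw [show 2 * (m + 1) = 2 * m + 1 + 1 by ring, Nat.factorial_succ, Nat.factorial_succ]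
    have e3 : (m + (n + 1)).factorial = (m + n + 1) * (m + n).factorial := by
      rw [← add_assoc, Nat.factorial_succ]
    have e4 : (m + 1 + n).factorial = (m + n + 1) * (m + n).factorial := by
      rw [show m + 1 + n = m + n + 1 by ring, Nat.factorial_succ]
    rw [e2, e4, Nat.factorial_succ m] at hc'
    rw [e1, e3, Nat.factorial_succ n]
    push_cast at hc' ⊢
    have hm : (m : ℤ) + 1 ≠ 0 := by positivity
    apply mul_left_cancel₀ hm
    linear_combination (4 * (n + 1) * (m + n + 1) * (m + 1) : ℤ) * hc - ((n : ℤ) + 1) * hc'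

/-- The number of interior peaks, `p₋(α) = #{i ≠ k : aᵢ > 1}` for `α = (a₁, …, aₖ)`. -/
def interiorPeaks {n : ℕ} (α : Composition n) : ℕ :=
  (Finset.univ.filter fun i : Fin α.length => (i : ℕ) + 1 ≠ α.length ∧ 1 < α.blocksFun i).card

/-- The number of augmented peaks: `p₊(α) = 1 + #{i ≠ 1, k : aᵢ > 1}` for `α = (a₁, …, aₖ)` with
`k > 1`, and `p₊(α) = 0` if `k ≤ 1`. -/
def augmentedPeaks {n : ℕ} (α : Composition n) : ℕ :=
  if 1 < α.length then
    1 + (Finset.univ.filter fun i : Fin α.length =>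
      (i : ℕ) ≠ 0 ∧ (i : ℕ) + 1 ≠ α.length ∧ 1 < α.blocksFun i).card
  else 0

end

noncomputable section

/-! ### Bivariate Catalan numbers -/

/-! A power series `f(t) = ∑ f(j) tʲ` defines a functional `w_f` (`parityWeight f`): on `M_α` it is
`(-1)ᵉ f(d)`, where `α` has `e` even and `d` odd terms, and it is `0` if the last term is even. The
map `f ↦ w_f` turns products of series into convolution products (`sum_parityWeight_take_mul_drop`)
and `t ↦ -t` into the bar operation, so `f(t) f(-t) = 1` makes `w_f` odd. The odd part `ζ₋` is `w_f`
for `f = √((1+t)/(1-t)) = (1+t)(1-t²)^(-1/2)`, whose coefficients are `f(j) = C(0,⌊j/2⌋)/4^⌊j/2⌋`.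
The even part is then forced to be `ζ₊ = ζ ζ̄₋`; it is even because `f(2m+1) = f(2m)`. The pair is
unique by induction on the length of `α`, using that `2` is invertible.

The value on `F_α` is a sum over the refinements of `α`. Cancellation in this sum leaves a simple
rule for removing the first term `a`: it replaces `f(j)` by `f(j+a)` if `a = 1` or `a` is the last
term, and by the difference `f(j+a) - f(j+a-2)` otherwise (`sum_parityWeight_add_two_cons`). So
`p₋(α)` counts iterated differences with step `2`. The recurrence `C(m+1,n) + C(m,n+1) = 4 C(m,n)`
says that these differences are again bivariate Catalan numbers, up to sign and a power of `4`,
which gives `ζ₋(F_α)`.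

For `ζ₊` and `α` with at least two terms, the first term `a` always produces the single difference
`f(j+a) - f(j+a-1)`, whatever its size. For even `n` this too amounts to a difference with step `2`,
which explains the summand `1` in `p₊(α)`. -/

theorem bivariateCatalan_mul (m n : ℕ) :
    bivariateCatalan m n * (m.factorial * (m + n).factorial * n.factorial) =
      (2 * m).factorial * (2 * n).factorial :=
  Nat.div_mul_cancel (bivariateCatalan_dvd m n)

theorem bivariateCatalan_cast_rat (m n : ℕ) :
    (bivariateCatalan m n : ℚ) = (2 * m).factorial * (2 * n).factorial /
      (m.factorial * (m + n).factorial * n.factorial) := by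
  rw [eq_div_iff (by positivity)]
  exact_mod_cast bivariateCatalan_mul m n

/-- The ratios of the two terms on the left to `C(m,n)` are `2(2m+1)/(m+n+1)` and `2(2n+1)/(m+n+1)`,
with sum `4`. -/
theorem bivariateCatalan_recurrence (m n : ℕ) :
    bivariateCatalan (m + 1) n + bivariateCatalan m (n + 1) = 4 * bivariateCatalan m n := by
  have double : ∀ k : ℕ, ((2 * (k + 1)).factorial : ℚ) =
      (2 * k + 2) * ((2 * k + 1) * (2 * k).factorial) := fun k => by
    rw [show 2 * (k + 1) = 2 * k + 1 + 1 by ring, Nat.factorial_succ, Nat.factorial_succ]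
    push_cast
    ring
  have h : (bivariateCatalan (m + 1) n : ℚ) + bivariateCatalan m (n + 1) =
      4 * bivariateCatalan m n := by
    simp only [bivariateCatalan_cast_rat, double]
    rw [show m + 1 + n = m + n + 1 by ring, show m + (n + 1) = m + n + 1 by ring]
    simp only [Nat.factorial_succ]
    push_cast
    have h1 : ((m + n).factorial : ℚ) ≠ 0 := by positivity
    have h2 : (m.factorial : ℚ) ≠ 0 := by positivity
    have h3 : (n.factorial : ℚ) ≠ 0 := by positivity
    have h4 : (m : ℚ) + n + 1 ≠ 0 := by positivity
    have h5 : (m : ℚ) + 1 ≠ 0 := by positivity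
    have h6 : (n : ℚ) + 1 ≠ 0 := by positivity
    field_simp
    ring
  exact_mod_cast h

theorem bivariateCatalan_zero_left (n : ℕ) : bivariateCatalan 0 n = n.centralBinom := by
  have h : (bivariateCatalan 0 n : ℚ) = n.centralBinom := by
    rw [bivariateCatalan_cast_rat, Nat.centralBinom_eq_two_mul_choose,
      Nat.cast_choose ℚ (by omega : n ≤ 2 * n), show 2 * n - n = n by omega]
    simp
  exact_mod_cast h

/-- This is the square of `(1-4x)^(-1/2)`. With `S` the sum and `T` the same sum weighted by the
first index, symmetry gives `2 T(k) = k S(k)`, and the recurrence of the central binomials gives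
`T(m+1) = 4 T(m) + 2 S(m)`; hence `S(m+1) = 4 S(m)`. -/
theorem sum_centralBinom_mul_centralBinom (m : ℕ) :
    ∑ p ∈ Finset.HasAntidiagonal.antidiagonal m, p.1.centralBinom * p.2.centralBinom = 4 ^ m := by
  induction m with
  | zero => simp
  | succ m ih =>
    have symm : ∀ k : ℕ,
        2 * ∑ p ∈ Finset.HasAntidiagonal.antidiagonal k, p.1 * (p.1.centralBinom * p.2.centralBinom) =
          k * ∑ p ∈ Finset.HasAntidiagonal.antidiagonal k, p.1.centralBinom * p.2.centralBinom := fun k => by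
      have h := Finset.Nat.sum_antidiagonal_swap (n := k)
        (f := fun p => p.1 * (p.1.centralBinom * p.2.centralBinom))
      rw [two_mul]
      nth_rewrite 1 [← h]
      rw [← Finset.sum_add_distrib, Finset.mul_sum]
      refine Finset.sum_congr rfl fun p hp => ?_
      rw [← Finset.HasAntidiagonal.mem_antidiagonal.1 hp]
      simp only [Prod.fst_swap, Prod.snd_swap]
      ring
    have step : ∑ p ∈ Finset.HasAntidiagonal.antidiagonal (m + 1), p.1 * (p.1.centralBinom * p.2.centralBinom) =
        2 * (2 * ∑ p ∈ Finset.HasAntidiagonal.antidiagonal m, p.1 * (p.1.centralBinom * p.2.centralBinom)) +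
          2 * ∑ p ∈ Finset.HasAntidiagonal.antidiagonal m, p.1.centralBinom * p.2.centralBinom := by
      rw [Finset.Nat.sum_antidiagonal_succ]
      simp only [zero_mul, zero_add, Finset.mul_sum]
      rw [← Finset.sum_add_distrib]
      refine Finset.sum_congr rfl fun p _ => ?_
      rw [← mul_assoc, Nat.succ_mul_centralBinom_succ]
      ring
    have h := symm (m + 1)
    rw [step, symm m, ih] at h
    have : (m + 1) * ∑ p ∈ Finset.HasAntidiagonal.antidiagonal (m + 1), p.1.centralBinom * p.2.centralBinom =
        (m + 1) * 4 ^ (m + 1) := by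
      rw [← h]
      ring
    exact Nat.eq_of_mul_eq_mul_left m.succ_pos this

/-- The numbers `(-1)ᵖ C(p, m) / 4^(p + m)`, `m = ⌊q / 2⌋`, which form the table of iterated
differences, with step `2`, of the sequence `q ↦ C(0, m) / 4ᵐ`. -/
def catalanDiff (𝕜 : Type*) [Field 𝕜] (p q : ℕ) : 𝕜 :=
  (-1) ^ p * bivariateCatalan p (q / 2) / 4 ^ (p + q / 2)

theorem catalanDiff_zero_zero {𝕜 : Type*} [Field 𝕜] : catalanDiff 𝕜 0 0 = 1 := by
  simp [catalanDiff, bivariateCatalan]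

theorem catalanDiff_odd {𝕜 : Type*} [Field 𝕜] (p m : ℕ) :
    catalanDiff 𝕜 p (2 * m + 1) = catalanDiff 𝕜 p (2 * m) := by
  unfold catalanDiff
  rw [show (2 * m + 1) / 2 = 2 * m / 2 by omega]

/-- The Catalan recurrence divided by `4^(p + q/2 + 1)`: row `p + 1` of the table is the step-`2`
difference of row `p`. -/
theorem catalanDiff_succ_left {𝕜 : Type*} [Field 𝕜] (h2 : (2 : 𝕜) ≠ 0) (p q : ℕ) :
    catalanDiff 𝕜 (p + 1) q = catalanDiff 𝕜 p (q + 2) - catalanDiff 𝕜 p q := by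
  have h4 : (4 : 𝕜) ≠ 0 := by
    rw [show (4 : 𝕜) = 2 * 2 by norm_num]
    exact mul_ne_zero h2 h2
  have h := congrArg (Nat.cast : ℕ → 𝕜) (bivariateCatalan_recurrence p (q / 2))
  push_cast at h
  unfold catalanDiff
  rw [show (q + 2) / 2 = q / 2 + 1 by omega, eq_sub_of_add_eq h]
  field_simp
  ring

theorem sum_antidiagonal_two_mul_add_one {M : Type*} [AddCommMonoid M] (u : ℕ → ℕ → M) (m : ℕ) :
    ∑ p ∈ Finset.HasAntidiagonal.antidiagonal (2 * m + 1), u p.1 p.2 =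
      ∑ p ∈ Finset.HasAntidiagonal.antidiagonal m,
        (u (2 * p.1) (2 * p.2 + 1) + u (2 * p.1 + 1) (2 * p.2)) := by
  induction m generalizing u with
  | zero => simp [Finset.Nat.sum_antidiagonal_succ]
  | succ m ih =>
    rw [show 2 * (m + 1) + 1 = 2 * m + 1 + 1 + 1 by ring, Finset.Nat.sum_antidiagonal_succ,
      Finset.Nat.sum_antidiagonal_succ, Finset.Nat.sum_antidiagonal_succ (n := m),
      ih fun i j => u (i + 1 + 1) j, ← add_assoc]
    rfl

theorem sum_antidiagonal_two_mul_add_two {M : Type*} [AddCommMonoid M] (u : ℕ → ℕ → M) (m : ℕ) :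
    ∑ p ∈ Finset.HasAntidiagonal.antidiagonal (2 * m + 2), u p.1 p.2 =
      ∑ p ∈ Finset.HasAntidiagonal.antidiagonal (m + 1), u (2 * p.1) (2 * p.2) +
        ∑ p ∈ Finset.HasAntidiagonal.antidiagonal m, u (2 * p.1 + 1) (2 * p.2 + 1) := by
  rw [Finset.Nat.sum_antidiagonal_succ, sum_antidiagonal_two_mul_add_one fun i j => u (i + 1) j,
    Finset.Nat.sum_antidiagonal_succ (n := m), Finset.sum_add_distrib,
    add_comm (∑ p ∈ Finset.HasAntidiagonal.antidiagonal m, u (2 * p.1 + 1) (2 * p.2 + 1)),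
    ← add_assoc]
  rfl

/-- With `f(j) = C(0, ⌊j/2⌋) / 4^⌊j/2⌋`, the power series `∑ f(j) tʲ` and `∑ f(j) (-t)ʲ` are
inverse to each other. -/
theorem sum_catalanDiff_mul {𝕜 : Type*} [Field 𝕜] (h2 : (2 : 𝕜) ≠ 0) (n : ℕ) :
    ∑ p ∈ Finset.HasAntidiagonal.antidiagonal n, catalanDiff 𝕜 0 p.1 * ((-1) ^ p.2 * catalanDiff 𝕜 0 p.2) =
      if n = 0 then 1 else 0 := by
  have h4 : (4 : 𝕜) ≠ 0 := by
    rw [show (4 : 𝕜) = 2 * 2 by norm_num]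
    exact mul_ne_zero h2 h2
  have hconv : ∀ m, ∑ p ∈ Finset.HasAntidiagonal.antidiagonal m,
      catalanDiff 𝕜 0 (2 * p.1) * catalanDiff 𝕜 0 (2 * p.2) = 1 := fun m => by
    have h := congrArg (Nat.cast : ℕ → 𝕜) (sum_centralBinom_mul_centralBinom m)
    push_cast at h
    rw [← div_self (pow_ne_zero m h4)]
    nth_rewrite 1 [← h]
    rw [Finset.sum_div]
    refine Finset.sum_congr rfl fun p hp => ?_
    rw [← Finset.HasAntidiagonal.mem_antidiagonal.1 hp]
    simp only [catalanDiff, bivariateCatalan_zero_left, Nat.mul_div_cancel_left _ two_pos,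
      pow_zero, one_mul, zero_add, pow_add]
    rw [div_mul_div_comm]
  obtain rfl | ⟨m, rfl⟩ | ⟨m, rfl⟩ : n = 0 ∨ (∃ m, n = 2 * m + 1) ∨ ∃ m, n = 2 * m + 2 := by
    rcases n.even_or_odd' with ⟨m, rfl | rfl⟩
    · cases m with
      | zero => exact Or.inl rfl
      | succ m => exact Or.inr (Or.inr ⟨m, by ring⟩)
    · exact Or.inr (Or.inl ⟨m, rfl⟩)
  · simp [catalanDiff_zero_zero]
  · rw [sum_antidiagonal_two_mul_add_one fun i j =>
      catalanDiff 𝕜 0 i * ((-1) ^ j * catalanDiff 𝕜 0 j), if_neg (by omega)]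
    -- The indices `(2i, 2j+1)` and `(2i+1, 2j)` contribute the same product with opposite signs.
    refine Finset.sum_eq_zero fun p _ => ?_
    rw [catalanDiff_odd, catalanDiff_odd, pow_succ, pow_mul]
    ring
  · have heven : ∀ j, (-1 : 𝕜) ^ (2 * j) = 1 := fun j => (even_two_mul j).neg_one_pow
    -- The pairs of even indices contribute `1` by `hconv`, the pairs of odd indices `-1`.
    rw [sum_antidiagonal_two_mul_add_two fun i j =>
      catalanDiff 𝕜 0 i * ((-1) ^ j * catalanDiff 𝕜 0 j), if_neg (by omega)]
    simp only [catalanDiff_odd, pow_succ, heven, one_mul, mul_neg, neg_mul,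
      Finset.sum_neg_distrib, mul_one, hconv, add_neg_cancel]

/-! ### Weights of sequences by the parities of their terms -/

/-- If the last term of `α` is odd or `α` is empty, then `(-1)ᵉ f(d)`, where `e` and `d` are the
numbers of even and of odd terms of `α`; otherwise `0`. -/
def parityWeight {𝕜 : Type*} [Field 𝕜] : (ℕ → 𝕜) → List ℕ → 𝕜
  | f, [] => f 0
  | f, a :: t => if Odd a then parityWeight (fun j => f (j + 1)) t
      else if t = [] then 0 else -parityWeight f t

theorem parityWeight_cons_of_odd {𝕜 : Type*} [Field 𝕜] (f : ℕ → 𝕜) {a : ℕ} (ha : Odd a)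
    (t : List ℕ) : parityWeight f (a :: t) = parityWeight (fun j => f (j + 1)) t := by
  rw [parityWeight, if_pos ha]

theorem parityWeight_cons_of_even {𝕜 : Type*} [Field 𝕜] (f : ℕ → 𝕜) {a : ℕ} (ha : Even a)
    (t : List ℕ) : parityWeight f (a :: t) = if t = [] then 0 else -parityWeight f t := by
  rw [parityWeight, if_neg (Nat.not_odd_iff_even.2 ha)]

theorem parityWeight_add {𝕜 : Type*} [Field 𝕜] (f g : ℕ → 𝕜) (α : List ℕ) :
    parityWeight (fun j => f j + g j) α = parityWeight f α + parityWeight g α := by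
  induction α generalizing f g with
  | nil => rfl
  | cons a t ih =>
    simp only [parityWeight, ih]
    split_ifs
    · rfl
    · simp
    · ring

theorem parityWeight_const_mul {𝕜 : Type*} [Field 𝕜] (c : 𝕜) (f : ℕ → 𝕜) (α : List ℕ) :
    parityWeight (fun j => c * f j) α = c * parityWeight f α := by
  induction α generalizing f with
  | nil => rfl
  | cons a t ih =>
    simp only [parityWeight, ih]
    split_ifs
    · rfl
    · simp
    · ring

/-- The number of odd terms has the parity of the sum. Thus `t ↦ -t` on series corresponds to the
bar operation on functionals. -/
theorem parityWeight_neg_one_pow_mul {𝕜 : Type*} [Field 𝕜] (f : ℕ → 𝕜) (α : List ℕ) :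
    parityWeight (fun j => (-1) ^ j * f j) α = (-1) ^ α.sum * parityWeight f α := by
  induction α generalizing f with
  | nil => simp [parityWeight]
  | cons a t ih =>
    rcases a.even_or_odd with ha | ha
    · rw [parityWeight_cons_of_even _ ha, parityWeight_cons_of_even _ ha, ih, List.sum_cons,
        pow_add, ha.neg_one_pow]
      split_ifs <;> ring
    · rw [parityWeight_cons_of_odd _ ha, parityWeight_cons_of_odd _ ha, List.sum_cons, pow_add,
        ha.neg_one_pow, mul_assoc, ← ih, ← parityWeight_const_mul]
      congr 1
      ext j
      ring

/-- The series `1` gives the counit: a nonempty sequence either ends in an even term or contains an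
odd one, and the weight vanishes both times. -/
theorem parityWeight_single_zero {𝕜 : Type*} [Field 𝕜] (α : List ℕ) :
    parityWeight (fun j => if j = 0 then (1 : 𝕜) else 0) α = if α.length = 0 then 1 else 0 := by
  have hz : ∀ β : List ℕ, parityWeight (fun _ => (0 : 𝕜)) β = 0 := fun β => by
    have h := parityWeight_const_mul (0 : 𝕜) (fun _ => 0) β
    simpa using h
  induction α with
  | nil => simp [parityWeight]
  | cons a t ih =>
    rcases a.even_or_odd with ha | ha
    · rw [parityWeight_cons_of_even _ ha, ih]
      by_cases ht : t = [] <;> simp [ht]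
    · rw [parityWeight_cons_of_odd _ ha]
      simp [hz]

/-- Multiplicativity of the weights: deconcatenation of sequences corresponds to the Cauchy product
of series. -/
theorem sum_parityWeight_take_mul_drop {𝕜 : Type*} [Field 𝕜] (f g : ℕ → 𝕜) (α : List ℕ) :
    ∑ i ∈ Finset.range (α.length + 1), parityWeight f (α.take i) * parityWeight g (α.drop i) =
      parityWeight (fun n => ∑ p ∈ Finset.HasAntidiagonal.antidiagonal n, f p.1 * g p.2) α := by
  induction α generalizing f with
  | nil => simp [parityWeight]
  | cons a t ih =>
    rw [Finset.sum_range_succ']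
    simp only [List.take_succ_cons, List.drop_succ_cons, List.take_zero, List.drop_zero]
    rw [show parityWeight f [] = f 0 from rfl]
    rcases a.even_or_odd with ha | ha
    -- An even first term should only change the sign of the sum for `t`. The exception is the
    -- prefix `[a]`, which has weight `0` instead of `-f 0`; for `t ≠ []` the extra summand from the
    -- empty prefix, `f 0` times `-parityWeight g t`, makes up for it.
    · have key : ∀ i, parityWeight f (a :: t.take i) =
          (if t.take i = [] then f 0 else 0) - parityWeight f (t.take i) := fun i => by
        rw [parityWeight_cons_of_even _ ha]
        split_ifs with h
        · rw [h, parityWeight, sub_self]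
        · ring
      simp only [parityWeight_cons_of_even _ ha, List.length_cons]
      rw [← ih]
      by_cases ht : t = []
      · subst ht
        simp
      · have hlen : t.length ≠ 0 := by simpa using ht
        simp only [ht, if_false]
        rw [Finset.sum_range_succ', Finset.sum_range_succ']
        simp only [List.take_zero, List.drop_zero, if_true, zero_mul, add_zero, List.take_eq_nil_iff,
          ht, or_false, Nat.succ_ne_zero, if_false]
        rw [show parityWeight f [] = f 0 from rfl, neg_add, ← Finset.sum_neg_distrib]
        simp only [neg_mul, mul_neg]
    · simp only [parityWeight_cons_of_odd _ ha, List.length_cons]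
      rw [ih fun j => f (j + 1), ← parityWeight_const_mul, ← parityWeight_add]
      congr 1
      ext n
      rw [Finset.Nat.sum_antidiagonal_succ, add_comm]

/-! ### Refinements of sequences -/

/-- `x` is a partial sum of the sequence. -/
def IsPartialSum : List ℕ → ℕ → Prop
  | [], x => x = 0
  | a :: t, x => x = 0 ∨ (a ≤ x ∧ IsPartialSum t (x - a))

theorem isPartialSum_zero (α : List ℕ) : IsPartialSum α 0 := by
  cases α with
  | nil => rfl
  | cons a t => exact Or.inl rfl

theorem isPartialSum_iff (α : List ℕ) (x : ℕ) :
    IsPartialSum α x ↔ ∃ i ≤ α.length, (α.take i).sum = x := by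
  induction α generalizing x with
  | nil => simp [IsPartialSum, eq_comm]
  | cons a t ih =>
    simp only [IsPartialSum, ih]
    constructor
    · rintro (rfl | ⟨hx, i, hi, h⟩)
      · exact ⟨0, by simp⟩
      · exact ⟨i + 1, by simpa using hi, by simp only [List.take_succ_cons, List.sum_cons]; omega⟩
    · rintro ⟨i, hi, h⟩
      cases i with
      | zero => left; simpa using h.symm
      | succ i =>
        simp only [List.take_succ_cons, List.sum_cons, List.length_cons] at h hi
        exact Or.inr ⟨by omega, i, by omega, by omega⟩

/-- The refinements of a sequence of positive integers. -/
def refinements : List ℕ → Finset (List ℕ)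
  | [] => {[]}
  | 0 :: _ => ∅
  | 1 :: t => (refinements t).image (List.cons 1)
  | (a + 2) :: t => (refinements ((a + 1) :: t)).image (List.cons 1) ∪
      (refinements ((a + 1) :: t)).image (List.modifyHead (· + 1))
termination_by α => α.sum
decreasing_by all_goals simp +arith

theorem exists_cons_of_mem_refinements {a : ℕ} {t β : List ℕ} (h : β ∈ refinements (a :: t)) :
    ∃ b s, β = (b + 1) :: s := by
  induction a generalizing β with
  | zero => simp [refinements] at h
  | succ a ih =>
    cases a with
    | zero =>
      simp only [refinements, zero_add, Finset.mem_image] at h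
      obtain ⟨s, -, rfl⟩ := h
      exact ⟨0, s, rfl⟩
    | succ a =>
      simp only [refinements, Finset.mem_union, Finset.mem_image] at h
      obtain ⟨s, -, rfl⟩ | ⟨γ, hγ, rfl⟩ := h
      · exact ⟨0, s, rfl⟩
      · obtain ⟨b, s, rfl⟩ := ih hγ
        exact ⟨b + 1, s, rfl⟩

theorem modifyHead_succ_injective :
    Function.Injective (List.modifyHead (· + 1) : List ℕ → List ℕ) := by
  intro β γ h
  cases β <;> cases γ <;> simp_all

theorem sum_refinements_one_cons {M : Type*} [AddCommMonoid M] (w : List ℕ → M) (t : List ℕ) :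
    ∑ β ∈ refinements (1 :: t), w β = ∑ β ∈ refinements t, w (1 :: β) := by
  rw [refinements, Finset.sum_image fun _ _ _ _ h => List.cons_injective h]

/-- The two kinds of refinements are disjoint: the first begin with `1`, the second with a term
greater than `1`. All later sums are computed from this recursion. -/
theorem sum_refinements_add_two_cons {M : Type*} [AddCommMonoid M] (w : List ℕ → M) (a : ℕ)
    (t : List ℕ) :
    ∑ β ∈ refinements ((a + 2) :: t), w β = ∑ β ∈ refinements ((a + 1) :: t), w (1 :: β) +
      ∑ β ∈ refinements ((a + 1) :: t), w (β.modifyHead (· + 1)) := by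
  rw [refinements, Finset.sum_union, Finset.sum_image fun _ _ _ _ h => List.cons_injective h,
    Finset.sum_image fun _ _ _ _ h => modifyHead_succ_injective h]
  rw [Finset.disjoint_left]
  intro β h1 h2
  obtain ⟨s, -, rfl⟩ := Finset.mem_image.1 h1
  obtain ⟨γ, hγ, h⟩ := Finset.mem_image.1 h2
  obtain ⟨b, s', rfl⟩ := exists_cons_of_mem_refinements hγ
  simp at h

/-- Links the recursive enumeration with refinement in terms of partial sums. In each inductive step
both first terms are lowered by one (a term `1` being removed), which shifts the nonzero partial
sums by one. -/
theorem mem_refinements_iff (α β : List ℕ) (hα : ∀ x ∈ α, 0 < x) (hβ : ∀ x ∈ β, 0 < x) :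
    β ∈ refinements α ↔
      β.sum = α.sum ∧ ∀ x, IsPartialSum α x → IsPartialSum β x := by
  induction hn : α.sum using Nat.strong_induction_on generalizing α β with
  | _ n ih =>
  subst hn
  match α, β with
  | [], [] => simp [refinements]
  | [], b :: s =>
    have := hβ b (by simp)
    simp [refinements]
    omega
  | 0 :: t, β => exact absurd (hα 0 (by simp)) (lt_irrefl _)
  | (a + 1) :: t, [] =>
    constructor
    · intro h
      obtain ⟨b, s, h⟩ := exists_cons_of_mem_refinements h
      simp at h
    · rintro ⟨h, -⟩
      simp at h
      omega
  | a :: t, 0 :: s => exact absurd (hβ 0 (by simp)) (lt_irrefl _)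
  | 1 :: t, (b + 1) :: s =>
    rw [List.forall_mem_cons] at hα hβ
    have hmem : (b + 1) :: s ∈ refinements (1 :: t) ↔ b = 0 ∧ s ∈ refinements t := by
      simp only [refinements, Finset.mem_image, List.cons.injEq]
      constructor
      · rintro ⟨_, h, h', rfl⟩
        exact ⟨by omega, h⟩
      · rintro ⟨rfl, h⟩
        exact ⟨s, h, rfl, rfl⟩
    rw [hmem, ih t.sum (by simp) t s hα.2 hβ.2 rfl]
    simp only [IsPartialSum, List.sum_cons]
    constructor
    · rintro ⟨rfl, hs, h⟩
      refine ⟨by omega, ?_⟩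
      rintro x (rfl | ⟨hx, h'⟩)
      · exact Or.inl rfl
      · exact Or.inr ⟨hx, h _ h'⟩
    · rintro ⟨hs, h⟩
      obtain rfl : b = 0 := by
        have := h 1 (Or.inr ⟨le_rfl, isPartialSum_zero t⟩)
        omega
      refine ⟨rfl, by omega, fun x hx => ?_⟩
      have := h (x + 1) (Or.inr ⟨by omega, by simpa using hx⟩)
      simpa using this
  | (a + 2) :: t, 1 :: s =>
    rw [List.forall_mem_cons] at hα hβ
    have hmem : 1 :: s ∈ refinements ((a + 2) :: t) ↔ s ∈ refinements ((a + 1) :: t) := by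
      simp only [refinements, Finset.mem_union, Finset.mem_image, List.cons.injEq, true_and,
        exists_eq_right, or_iff_left_iff_imp]
      rintro ⟨γ, hγ, h⟩
      obtain ⟨b, s', rfl⟩ := exists_cons_of_mem_refinements hγ
      simp at h
    rw [hmem, ih ((a + 1) :: t).sum (by simp) ((a + 1) :: t) s
      (List.forall_mem_cons.2 ⟨by omega, hα.2⟩) hβ.2 rfl]
    simp only [IsPartialSum, List.sum_cons]
    constructor
    · rintro ⟨hs, h⟩
      refine ⟨by omega, ?_⟩
      rintro x (rfl | ⟨hx, h'⟩)
      · exact Or.inl rfl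
      · refine Or.inr ⟨by omega, h _ (Or.inr ⟨by omega, ?_⟩)⟩
        rwa [show x - 1 - (a + 1) = x - (a + 2) by omega]
    · rintro ⟨hs, h⟩
      refine ⟨by omega, ?_⟩
      rintro x (rfl | ⟨hx, h'⟩)
      · exact isPartialSum_zero s
      · have := h (x + 1) (Or.inr ⟨by omega, by
          rwa [show x + 1 - (a + 2) = x - (a + 1) by omega]⟩)
        simpa using this
  | (a + 2) :: t, (b + 2) :: s =>
    rw [List.forall_mem_cons] at hα hβ
    have hmem : (b + 2) :: s ∈ refinements ((a + 2) :: t) ↔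
        (b + 1) :: s ∈ refinements ((a + 1) :: t) := by
      rw [refinements, Finset.mem_union]
      constructor
      · rintro (h | h)
        · obtain ⟨γ, -, h⟩ := Finset.mem_image.1 h
          simp at h
        · obtain ⟨γ, hγ, h⟩ := Finset.mem_image.1 h
          rwa [modifyHead_succ_injective (h.trans (by rfl : _ =
            List.modifyHead (· + 1) ((b + 1) :: s)))] at hγ
      · exact fun h => Or.inr (Finset.mem_image.2 ⟨_, h, rfl⟩)
    rw [hmem, ih ((a + 1) :: t).sum (by simp) ((a + 1) :: t) ((b + 1) :: s)
      (List.forall_mem_cons.2 ⟨by omega, hα.2⟩) (List.forall_mem_cons.2 ⟨by omega, hβ.2⟩) rfl]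
    simp only [IsPartialSum, List.sum_cons]
    constructor
    · rintro ⟨hs, h⟩
      refine ⟨by omega, ?_⟩
      rintro x (rfl | ⟨hx, h'⟩)
      · exact Or.inl rfl
      · rcases h (x - 1) (Or.inr ⟨by omega, by
          rwa [show x - 1 - (a + 1) = x - (a + 2) by omega]⟩) with h | ⟨h1, h2⟩
        · omega
        · refine Or.inr ⟨by omega, ?_⟩
          rwa [show x - 1 - (b + 1) = x - (b + 2) by omega] at h2
    · rintro ⟨hs, h⟩
      refine ⟨by omega, ?_⟩
      rintro x (rfl | ⟨hx, h'⟩)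
      · exact Or.inl rfl
      · rcases h (x + 1) (Or.inr ⟨by omega, by
          rwa [show x + 1 - (a + 2) = x - (a + 1) by omega]⟩) with h | ⟨h1, h2⟩
        · omega
        · refine Or.inr ⟨by omega, ?_⟩
          rwa [show x + 1 - (b + 2) = x - (b + 1) by omega] at h2

theorem pos_of_mem_refinements {α β : List ℕ} (h : β ∈ refinements α) : ∀ x ∈ β, 0 < x := by
  induction hn : α.sum using Nat.strong_induction_on generalizing α β with
  | _ n ih =>
  subst hn
  match α with
  | [] => simp_all [refinements]
  | 0 :: t => simp [refinements] at h
  | 1 :: t =>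
    rw [refinements, Finset.mem_image] at h
    obtain ⟨s, hs, rfl⟩ := h
    exact List.forall_mem_cons.2 ⟨one_pos, ih t.sum (by simp) hs rfl⟩
  | (a + 2) :: t =>
    rw [refinements, Finset.mem_union, Finset.mem_image, Finset.mem_image] at h
    obtain ⟨s, hs, rfl⟩ | ⟨s, hs, rfl⟩ := h
    · exact List.forall_mem_cons.2 ⟨one_pos, ih _ (by simp) hs rfl⟩
    · have hpos := ih _ (by simp) hs rfl
      obtain ⟨b, s, rfl⟩ := exists_cons_of_mem_refinements hs
      rw [List.forall_mem_cons] at hpos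
      exact List.forall_mem_cons.2 ⟨Nat.succ_pos _, hpos.2⟩

theorem mem_boundaries_iff {n : ℕ} (α : Composition n) (x : Fin (n + 1)) :
    x ∈ α.boundaries ↔ IsPartialSum α.blocks x := by
  rw [isPartialSum_iff, Composition.boundaries, Finset.mem_map]
  constructor
  · rintro ⟨i, -, rfl⟩
    exact ⟨i, Nat.lt_succ_iff.1 i.2, rfl⟩
  · rintro ⟨i, hi, h⟩
    exact ⟨⟨i, Nat.lt_succ_iff.2 hi⟩, Finset.mem_univ _, Fin.ext h⟩

theorem boundaries_subset_iff {n : ℕ} (α β : Composition n) :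
    α.boundaries ⊆ β.boundaries ↔ β.blocks ∈ refinements α.blocks := by
  rw [mem_refinements_iff _ _ (fun _ h => α.blocks_pos h) fun _ h => β.blocks_pos h]
  constructor
  · intro h
    refine ⟨by rw [α.blocks_sum, β.blocks_sum], fun x hx => ?_⟩
    have hlt : x < n + 1 := by
      obtain ⟨i, -, rfl⟩ := (isPartialSum_iff _ _).1 hx
      exact Nat.lt_succ_of_le (α.sizeUpTo_le i)
    exact (mem_boundaries_iff β ⟨x, hlt⟩).1 (h ((mem_boundaries_iff α ⟨x, hlt⟩).2 hx))
  · rintro ⟨-, h⟩ x hx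
    exact (mem_boundaries_iff β x).2 (h x ((mem_boundaries_iff α x).1 hx))

theorem sum_boundaries_subset {M : Type*} [AddCommMonoid M] {n : ℕ} (α : Composition n)
    (w : List ℕ → M) :
    ∑ β : Composition n with α.boundaries ⊆ β.boundaries, w β.blocks =
      ∑ β ∈ refinements α.blocks, w β := by
  refine Finset.sum_bij (fun β _ => β.blocks) ?_ ?_ ?_ fun _ _ => rfl
  · intro β hβ
    exact (boundaries_subset_iff α β).1 (Finset.mem_filter.1 hβ).2
  · intro β _ γ _ h
    exact Composition.ext h
  · intro β hβ
    have hpos := pos_of_mem_refinements hβ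
    have hsum := ((mem_refinements_iff _ _ (fun _ h => α.blocks_pos h) hpos).1 hβ).1
    let γ : Composition n := ⟨β, fun h => hpos _ h, hsum.trans α.blocks_sum⟩
    exact ⟨γ, Finset.mem_filter.2 ⟨Finset.mem_univ _, (boundaries_subset_iff α γ).2 hβ⟩, rfl⟩

/-! ### Sums of weights over refinements -/

theorem refinements_nil_iff {α β : List ℕ} (h : β ∈ refinements α) : β = [] ↔ α = [] := by
  cases α with
  | nil => simpa [refinements] using h
  | cons a t =>
    obtain ⟨b, s, rfl⟩ := exists_cons_of_mem_refinements h
    simp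

theorem sum_refinements_nil {M : Type*} [AddCommMonoid M] (w : List ℕ → M) :
    ∑ β ∈ refinements [], w β = w [] := by
  simp [refinements]

section

variable {𝕜 : Type*} [Field 𝕜]

/-- A refinement is empty only if `t` is, so the exceptional value for a final even term occurs for
all refinements or for none. -/
theorem sum_parityWeight_even_cons (f : ℕ → 𝕜) {a : ℕ} (ha : Even a) (t : List ℕ) :
    ∑ β ∈ refinements t, parityWeight f (a :: β) =
      if t = [] then 0 else -∑ β ∈ refinements t, parityWeight f β := by
  split_ifs with ht
  · subst ht
    rw [sum_refinements_nil, parityWeight_cons_of_even _ ha, if_pos rfl]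
  · rw [← Finset.sum_neg_distrib]
    refine Finset.sum_congr rfl fun β hβ => ?_
    rw [parityWeight_cons_of_even _ ha, if_neg (mt (refinements_nil_iff hβ).1 ht)]

theorem sum_parityWeight_one_cons (f : ℕ → 𝕜) (t : List ℕ) :
    ∑ β ∈ refinements (1 :: t), parityWeight f β =
      ∑ β ∈ refinements t, parityWeight (fun j => f (j + 1)) β := by
  rw [sum_refinements_one_cons]
  simp only [parityWeight_cons_of_odd _ odd_one]

theorem sum_parityWeight_modifyHead_one (f : ℕ → 𝕜) (t : List ℕ) :
    ∑ β ∈ refinements (1 :: t), parityWeight f (β.modifyHead (· + 1)) =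
      if t = [] then 0 else -∑ β ∈ refinements t, parityWeight f β := by
  rw [sum_refinements_one_cons]
  exact sum_parityWeight_even_cons f even_two t

/-- Each refinement `γ` of `(a + 1) :: t` contributes twice: prepending `2` gives minus its weight,
and adding `2` to its first term preserves parity and hence gives its weight. -/
theorem sum_parityWeight_modifyHead_add_two (f : ℕ → 𝕜) (a : ℕ) (t : List ℕ) :
    ∑ β ∈ refinements ((a + 2) :: t), parityWeight f (β.modifyHead (· + 1)) = 0 := by
  rw [sum_refinements_add_two_cons, show (fun β : List ℕ => parityWeight f
    ((1 :: β).modifyHead (· + 1))) = fun β => parityWeight f (2 :: β) from rfl,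
    sum_parityWeight_even_cons f even_two, if_neg (by simp), neg_add_eq_zero]
  refine Finset.sum_congr rfl fun β hβ => ?_
  obtain ⟨b, s, rfl⟩ := exists_cons_of_mem_refinements hβ
  simp [parityWeight, Nat.odd_add_one]

/-- For a first term of at least `3` the refinements with first term greater than `1` cancel, so
lowering it by one just shifts `f`. At `2` the refinements beginning with the part `2` survive and
give the subtracted sum, unless `t` is empty. -/
theorem sum_parityWeight_add_two_cons (f : ℕ → 𝕜) (a : ℕ) (t : List ℕ) :
    ∑ β ∈ refinements ((a + 2) :: t), parityWeight f β =
      ∑ β ∈ refinements t, parityWeight (fun j => f (j + (a + 2))) β -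
        if t = [] then 0 else ∑ β ∈ refinements t, parityWeight (fun j => f (j + a)) β := by
  induction a generalizing f with
  | zero =>
    rw [sum_refinements_add_two_cons]
    simp only [parityWeight_cons_of_odd _ odd_one]
    rw [sum_parityWeight_one_cons, sum_parityWeight_modifyHead_one]
    split_ifs <;> simp [sub_eq_add_neg, add_assoc]
  | succ a ih =>
    rw [sum_refinements_add_two_cons, sum_parityWeight_modifyHead_add_two, add_zero]
    simp only [parityWeight_cons_of_odd _ odd_one]
    rw [ih fun j => f (j + 1)]
    simp only [show ∀ j, j + (a + 2) + 1 = j + (a + 1 + 2) from fun _ => rfl,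
      show ∀ j, j + a + 1 = j + (a + 1) from fun _ => rfl]

theorem sum_parityWeight_singleton (f : ℕ → 𝕜) (a : ℕ) :
    ∑ β ∈ refinements [a + 1], parityWeight f β = f (a + 1) := by
  cases a with
  | zero => rw [sum_parityWeight_one_cons, sum_refinements_nil, parityWeight]
  | succ a =>
    rw [sum_parityWeight_add_two_cons, sum_refinements_nil, parityWeight, if_pos rfl, sub_zero,
      zero_add]

/-- The number of terms greater than `1`, apart from the last term. -/
def listPeaks : List ℕ → ℕ
  | [] => 0
  | a :: t => (if t ≠ [] ∧ 1 < a then 1 else 0) + listPeaks t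

/-- Each counted term is at least `2`; the last term, never counted, makes the inequality strict.
The strict form is needed for the bound on `p₊`. -/
theorem two_mul_listPeaks_le {α : List ℕ} (hα : ∀ x ∈ α, 0 < x) :
    2 * listPeaks α ≤ α.sum ∧ (α ≠ [] → 2 * listPeaks α < α.sum) := by
  induction α with
  | nil => simp [listPeaks]
  | cons a t ih =>
    rw [List.forall_mem_cons] at hα
    have h := ih hα.2
    have ha := hα.1
    simp only [listPeaks, List.sum_cons]
    split_ifs with hc
    · have := h.2 hc.1
      omega
    · omega

/-- Here `p` records the differences already taken and `q` the shift already made, as the induction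
on `α` requires. Each peak trades two units of shift for one more difference, so the final shift is
`q` plus the sum of `α` minus twice the number of peaks. -/
theorem sum_parityWeight_catalanDiff (h2 : (2 : 𝕜) ≠ 0) {α : List ℕ} (hα : ∀ x ∈ α, 0 < x)
    (p q r : ℕ) (hr : 2 * listPeaks α + r = α.sum) :
    ∑ β ∈ refinements α, parityWeight (fun j => catalanDiff 𝕜 p (j + q)) β =
      catalanDiff 𝕜 (p + listPeaks α) (q + r) := by
  induction α generalizing p q r with
  | nil =>
    obtain rfl : r = 0 := by simpa [listPeaks] using hr
    rw [sum_refinements_nil]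
    simp [parityWeight, listPeaks]
  | cons a t ih =>
    rw [List.forall_mem_cons] at hα
    have hle := (two_mul_listPeaks_le hα.2).1
    obtain ⟨s, hs⟩ := Nat.exists_eq_add_of_le hle
    have shift : ∀ b, (fun j => catalanDiff 𝕜 p (j + b + q)) =
        fun j => catalanDiff 𝕜 p (j + (b + q)) := fun b => funext fun j => by rw [add_assoc]
    match a with
    | 0 => exact absurd hα.1 (lt_irrefl _)
    | 1 =>
      simp only [listPeaks, List.sum_cons, lt_irrefl, and_false, if_false, zero_add] at hr ⊢
      rw [sum_parityWeight_one_cons]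
      simp only [shift 1]
      rw [ih hα.2 p (1 + q) s hs.symm]
      congr 1
      omega
    | a + 2 =>
      rw [sum_parityWeight_add_two_cons]
      simp only [shift (a + 2), shift a]
      rw [ih hα.2 p (a + 2 + q) s hs.symm]
      simp only [listPeaks, List.sum_cons] at hr ⊢
      by_cases ht : t = []
      · simp only [ht, ne_eq, not_true_eq_false, false_and, if_false, if_true, sub_zero,
          listPeaks, List.sum_nil] at hr hs ⊢
        congr 1
        omega
      · rw [if_pos ⟨ht, by omega⟩] at hr
        rw [if_neg ht, if_pos ⟨ht, by omega⟩, ih hα.2 p (a + q) s hs.symm,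
          show p + (1 + listPeaks t) = p + listPeaks t + 1 by ring,
          catalanDiff_succ_left h2]
        congr 2 <;> omega

/-! ### Sums over refinements for the even part -/

/-- The weight `(-1)ᵃ w(t)` of the sequence with first term `a` and remaining terms `t`, where `w`
is `parityWeight f`. -/
def tailWeight (f : ℕ → 𝕜) : List ℕ → 𝕜
  | [] => 0
  | a :: t => (-1) ^ a * parityWeight f t

theorem sum_tailWeight_one_cons (f : ℕ → 𝕜) (t : List ℕ) :
    ∑ β ∈ refinements (1 :: t), tailWeight f β = -∑ β ∈ refinements t, parityWeight f β := by
  rw [sum_refinements_one_cons, ← Finset.sum_neg_distrib]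
  simp [tailWeight]

theorem sum_tailWeight_add_two_cons (f : ℕ → 𝕜) (a : ℕ) (t : List ℕ) :
    ∑ β ∈ refinements ((a + 2) :: t), tailWeight f β =
      -∑ β ∈ refinements ((a + 1) :: t), parityWeight f β -
        ∑ β ∈ refinements ((a + 1) :: t), tailWeight f β := by
  rw [sum_refinements_add_two_cons, sub_eq_add_neg, ← Finset.sum_neg_distrib,
    ← Finset.sum_neg_distrib]
  congr 1
  · simp [tailWeight]
  · refine Finset.sum_congr rfl fun β hβ => ?_
    obtain ⟨b, s, rfl⟩ := exists_cons_of_mem_refinements hβ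
    simp [tailWeight, pow_succ]

/-- The sums for one-term sequences alternate between `-f (2 * m)` at `2 * m + 1` and `0` at `2 * m
+ 2`. Hence on one-term compositions of positive even size the even and odd parts agree. -/
theorem sum_tailWeight_singleton (f : ℕ → 𝕜) (hf : ∀ m, f (2 * m + 1) = f (2 * m)) (m : ℕ) :
    ∑ β ∈ refinements [2 * m + 2], tailWeight f β = 0 := by
  have step : ∀ m, ∑ β ∈ refinements [2 * m + 1], tailWeight f β = -f (2 * m) →
      ∑ β ∈ refinements [2 * m + 2], tailWeight f β = 0 := fun m h => by
    rw [sum_tailWeight_add_two_cons, h, sum_parityWeight_singleton, hf]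
    ring
  have base : ∀ m, ∑ β ∈ refinements [2 * m + 1], tailWeight f β = -f (2 * m) := fun m => by
    induction m with
    | zero => rw [sum_tailWeight_one_cons, sum_refinements_nil, parityWeight]
    | succ m ih =>
      rw [show 2 * (m + 1) + 1 = 2 * m + 1 + 2 by ring, sum_tailWeight_add_two_cons, step m ih,
        sum_parityWeight_singleton, sub_zero]
      rfl
  exact step m (base m)

/-- Write `P b` for the sum over `refinements t` with `f` shifted by `b`. The inductive step is `-(P
(a+2) - P a) - (P a - P (a+1)) = P (a+1) - P (a+2)`. -/
theorem sum_tailWeight_add_two_cons_eq_sub (f : ℕ → 𝕜) (a : ℕ) {t : List ℕ} (ht : t ≠ []) :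
    ∑ β ∈ refinements ((a + 2) :: t), tailWeight f β =
      ∑ β ∈ refinements t, parityWeight (fun j => f (j + a)) β -
        ∑ β ∈ refinements t, parityWeight (fun j => f (j + (a + 1))) β := by
  induction a with
  | zero =>
    rw [sum_tailWeight_add_two_cons, sum_parityWeight_one_cons, sum_tailWeight_one_cons]
    simp only [add_zero, zero_add]
    ring
  | succ a ih =>
    rw [sum_tailWeight_add_two_cons, ih, sum_parityWeight_add_two_cons, if_neg ht,
      show a + 1 + 1 = a + 2 from rfl]
    ring

/-- The formula is the same for a first term equal to `1` and for a larger one; this is why `p₊`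
ignores the size of the first term. -/
theorem sum_parityWeight_add_tailWeight_cons (f : ℕ → 𝕜) (a : ℕ) {t : List ℕ} (ht : t ≠ []) :
    ∑ β ∈ refinements ((a + 1) :: t), (parityWeight f β + tailWeight f β) =
      ∑ β ∈ refinements t, parityWeight (fun j => f (j + (a + 1))) β -
        ∑ β ∈ refinements t, parityWeight (fun j => f (j + a)) β := by
  rw [Finset.sum_add_distrib]
  cases a with
  | zero =>
    rw [sum_parityWeight_one_cons, sum_tailWeight_one_cons, ← sub_eq_add_neg]
    rfl
  | succ a =>
    rw [sum_parityWeight_add_two_cons, sum_tailWeight_add_two_cons_eq_sub _ _ ht, if_neg ht,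
      show a + 1 + 1 = a + 2 from rfl]
    ring

theorem sum_parityWeight_add_tailWeight_catalanDiff (h2 : (2 : 𝕜) ≠ 0) {a : ℕ} {t : List ℕ}
    (ht : t ≠ []) (hpos : ∀ x ∈ t, 0 < x) (k : ℕ)
    (hk : 2 * (1 + listPeaks t) + 2 * k = a + 1 + t.sum) :
    ∑ β ∈ refinements ((a + 1) :: t),
        (parityWeight (catalanDiff 𝕜 0) β + tailWeight (catalanDiff 𝕜 0) β) =
      catalanDiff 𝕜 (1 + listPeaks t) (2 * k) := by
  obtain ⟨r, hr⟩ := Nat.exists_eq_add_of_le (two_mul_listPeaks_le hpos).1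
  have hlt := (two_mul_listPeaks_le hpos).2 ht
  rw [sum_parityWeight_add_tailWeight_cons _ _ ht,
    sum_parityWeight_catalanDiff h2 hpos 0 (a + 1) r hr.symm,
    sum_parityWeight_catalanDiff h2 hpos 0 a r hr.symm, zero_add,
    -- As the total size is even, `a + r` is odd; the values at `2 * k + 1` and `2 * k` agree, so
    -- the step-`1` difference is a step-`2` difference.
    show a + 1 + r = 2 * k + 2 by omega, show a + r = 2 * k + 1 by omega, catalanDiff_odd,
    add_comm 1, catalanDiff_succ_left h2]

end

/-! ### Peaks of compositions -/

theorem card_filter_eq_listPeaks (l : List ℕ) :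
    (Finset.univ.filter fun i : Fin l.length =>
      (i : ℕ) + 1 ≠ l.length ∧ 1 < l[(i : ℕ)]).card = listPeaks l := by
  induction l with
  | nil => rfl
  | cons a t ih =>
    rw [Finset.card_filter] at ih ⊢
    simp only [List.length_cons, Fin.sum_univ_succ, listPeaks, ← ih]
    simp [List.length_eq_zero_iff, eq_comm]

theorem interiorPeaks_eq_listPeaks {n : ℕ} (α : Composition n) :
    interiorPeaks α = listPeaks α.blocks :=
  card_filter_eq_listPeaks α.blocks

theorem card_filter_ne_zero_eq_listPeaks (a : ℕ) (t : List ℕ) :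
    (Finset.univ.filter fun i : Fin (a :: t).length =>
      (i : ℕ) ≠ 0 ∧ (i : ℕ) + 1 ≠ (a :: t).length ∧ 1 < (a :: t)[(i : ℕ)]).card = listPeaks t := by
  rw [← card_filter_eq_listPeaks, Finset.card_filter, Finset.card_filter]
  simp only [List.length_cons, Fin.sum_univ_succ]
  simp

theorem augmentedPeaks_eq_listPeaks {n : ℕ} (α : Composition n) {a : ℕ} {t : List ℕ}
    (h : α.blocks = a :: t) :
    augmentedPeaks α = if t = [] then 0 else 1 + listPeaks t := by
  have hcard : ∀ l : List ℕ, l = a :: t →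
      (Finset.univ.filter fun i : Fin l.length =>
        (i : ℕ) ≠ 0 ∧ (i : ℕ) + 1 ≠ l.length ∧ 1 < l[(i : ℕ)]).card = listPeaks t := by
    rintro _ rfl
    exact card_filter_ne_zero_eq_listPeaks a t
  have hlen : 1 < α.length ↔ t ≠ [] := by
    rw [Composition.length, h, List.length_cons, ← List.length_pos_iff]
    omega
  have hα := hcard α.blocks h
  unfold augmentedPeaks
  by_cases ht : t = []
  · rw [if_neg (by rw [hlen]; exact not_not.2 ht), if_pos ht]
  · rw [if_pos (hlen.2 ht), if_neg ht]
    exact congrArg (1 + ·) hα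

/-! ### Functionals on quasi-symmetric functions -/

section

variable {𝕜 : Type*} [Field 𝕜]

/-- The functional with value `w α` on `M_α`. -/
def listFunctional (w : List ℕ → 𝕜) : QSym 𝕜 →ₗ[𝕜] 𝕜 :=
  (monomialBasis 𝕜).constr 𝕜 fun c => w c.2.blocks

theorem listFunctional_monomialQSym (w : List ℕ → 𝕜) {α : List ℕ} (hα : ∀ x ∈ α, 0 < x) :
    listFunctional w (monomialQSym 𝕜 α) = w α := by
  have h := (monomialBasis 𝕜).constr_basis 𝕜 (fun c : Σ n, Composition n => w c.2.blocks)
    ⟨α.sum, ⟨α, fun h => hα _ h, rfl⟩⟩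
  rw [monomialBasis_apply] at h
  exact h

theorem conv_monomialQSym (φ ψ : WithConv (QSym 𝕜 →ₗ[𝕜] 𝕜)) {α : List ℕ} (hα : ∀ x ∈ α, 0 < x) :
    (φ * ψ).ofConv (monomialQSym 𝕜 α) = ∑ i ∈ Finset.range (α.length + 1),
      φ.ofConv (monomialQSym 𝕜 (α.take i)) * ψ.ofConv (monomialQSym 𝕜 (α.drop i)) := by
  have h : (φ * ψ).ofConv (monomialQSym 𝕜 α) = LinearMap.mul' 𝕜 𝕜
      (TensorProduct.map φ.ofConv ψ.ofConv (qsymComul 𝕜 (monomialQSym 𝕜 α))) := rfl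
  rw [h, qsymComul_monomialQSym α hα]
  simp

theorem convOne_monomialQSym (α : List ℕ) :
    (1 : WithConv (QSym 𝕜 →ₗ[𝕜] 𝕜)).ofConv (monomialQSym 𝕜 α) =
      if α.length = 0 then 1 else 0 := by
  have h : (1 : WithConv (QSym 𝕜 →ₗ[𝕜] 𝕜)).ofConv (monomialQSym 𝕜 α) =
    qsymCounit 𝕜 (monomialQSym 𝕜 α) := rfl
  rw [h, qsymCounit_monomialQSym]

theorem qsymBar_monomialQSym (α : List ℕ) :
    qsymBar 𝕜 (monomialQSym 𝕜 α) = (-1 : 𝕜) ^ α.sum • monomialQSym 𝕜 α := by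
  classical
  apply Subtype.ext
  ext m
  have h : MvPowerSeries.coeff m ((qsymBar 𝕜 (monomialQSym 𝕜 α) : QSym 𝕜) : MvPowerSeries ℕ 𝕜) =
    (-1) ^ m.degree * MvPowerSeries.coeff m (monomialQSym 𝕜 α : MvPowerSeries ℕ 𝕜) := rfl
  rw [h, SetLike.val_smul, map_smul, coeff_monomialQSym, smul_eq_mul]
  split_ifs with hm
  · rw [← hm, exponentList_sum]
  · rw [mul_zero, mul_zero]

theorem comp_qsymBar_monomialQSym (φ : QSym 𝕜 →ₗ[𝕜] 𝕜) (α : List ℕ) :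
    (φ ∘ₗ qsymBar 𝕜) (monomialQSym 𝕜 α) = (-1) ^ α.sum * φ (monomialQSym 𝕜 α) := by
  rw [LinearMap.comp_apply, qsymBar_monomialQSym, map_smul, smul_eq_mul]

theorem exponentList_single (d : ℕ) :
    exponentList (Finsupp.single 0 d) = if d = 0 then [] else [d] := by
  split_ifs with h
  · rw [h, Finsupp.single_zero, exponentList_eq_nil]
  · simp [exponentList, Finsupp.support_single, h]

theorem qsymZeta_monomialQSym {α : List ℕ} (hα : ∀ x ∈ α, 0 < x) :
    qsymZeta 𝕜 (monomialQSym 𝕜 α) = if α.length ≤ 1 then 1 else 0 := by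
  classical
  have h : qsymZeta 𝕜 (monomialQSym 𝕜 α) = (qsymOneVariable (monomialQSym 𝕜 α)).eval 1 := rfl
  have hcoeff : qsymOneVariable (monomialQSym 𝕜 α) =
      if α.length ≤ 1 then Polynomial.X ^ α.sum else 0 := by
    ext d
    rw [qsymOneVariable_coeff, coeff_monomialQSym, exponentList_single]
    match α with
    | [] => by_cases hd : d = 0 <;> simp [hd, Polynomial.coeff_one]
    | [a] =>
      have := hα a (by simp)
      by_cases hd : d = 0
      · subst hd
        simp [Polynomial.coeff_X_pow, this.ne]
      · simp [hd, Polynomial.coeff_X_pow]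
    | a :: b :: t => by_cases hd : d = 0 <;> simp [hd]
  rw [h, hcoeff]
  split_ifs <;> simp

theorem qsymF_eq_sum {n : ℕ} (α : Composition n) (φ : QSym 𝕜 →ₗ[𝕜] 𝕜) (w : List ℕ → 𝕜)
    (hw : ∀ β : List ℕ, (∀ x ∈ β, 0 < x) → φ (monomialQSym 𝕜 β) = w β) :
    φ (qsymF 𝕜 α) = ∑ β ∈ refinements α.blocks, w β := by
  rw [← sum_boundaries_subset, qsymF, map_sum]
  exact Finset.sum_congr rfl fun β _ => hw _ fun _ h => β.blocks_pos h

/-! ### Uniqueness of the even-odd decomposition -/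

theorem sum_range_take_drop_cons (u : List ℕ → List ℕ → 𝕜) (a : ℕ) (t : List ℕ) :
    ∑ i ∈ Finset.range ((a :: t).length + 1), u ((a :: t).take i) ((a :: t).drop i) =
      ∑ i ∈ Finset.range t.length, u (a :: t.take i) (t.drop i) + u [] (a :: t) +
        u (a :: t) [] := by
  rw [Finset.sum_range_succ, List.length_cons, Finset.sum_range_succ']
  simp

/-- Induction on the length of `α`. Apart from the extreme terms of the coproduct only shorter
sequences occur, so `ρ(M_α) + ψ(M_α)` is determined. For even degree oddness of `ψ` determines `2
ψ(M_α)`; for odd degree evenness of `ρ` forces `2 ρ(M_α) = 0`. -/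
theorem IsEvenOddDecomposition.unique (h2 : (2 : 𝕜) ≠ 0) {φ ρ ψ ρ' ψ' : QSym 𝕜 →ₗ[𝕜] 𝕜}
    (h : IsEvenOddDecomposition φ ρ ψ) (h' : IsEvenOddDecomposition φ ρ' ψ') :
    ρ = ρ' ∧ ψ = ψ' := by
  have key : ∀ k, ∀ α : List ℕ, α.length = k → (∀ x ∈ α, 0 < x) →
      ρ (monomialQSym 𝕜 α) = ρ' (monomialQSym 𝕜 α) ∧
        ψ (monomialQSym 𝕜 α) = ψ' (monomialQSym 𝕜 α) := by
    intro k
    induction k using Nat.strong_induction_on with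
    | _ k ih =>
    intro α hk hα
    match α with
    | [] =>
      rw [monomialQSym_nil, h.even_one, h'.even_one, h.odd_one, h'.odd_one]
      exact ⟨rfl, rfl⟩
    | a :: t =>
      have hlen : t.length + 1 = k := hk
      have htake : ∀ i ∈ Finset.range t.length,
          ρ (monomialQSym 𝕜 (a :: t.take i)) = ρ' (monomialQSym 𝕜 (a :: t.take i)) ∧
          ψ (monomialQSym 𝕜 (a :: t.take i)) = ψ' (monomialQSym 𝕜 (a :: t.take i)) :=
        fun i hi => ih (a :: t.take i).length (by
          rw [Finset.mem_range] at hi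
          rw [List.length_cons, List.length_take]
          omega) _ rfl fun x hx => hα x (by
            rw [List.mem_cons] at hx ⊢
            exact hx.imp_right List.mem_of_mem_take)
      have hdrop : ∀ i, ψ (monomialQSym 𝕜 (t.drop i)) = ψ' (monomialQSym 𝕜 (t.drop i)) :=
        fun i => (ih (t.drop i).length (by
          rw [List.length_drop]
          omega) _ rfl fun x hx => hα x (List.mem_cons_of_mem _ (List.mem_of_mem_drop hx))).2
      have expand : ∀ {ρ ψ : QSym 𝕜 →ₗ[𝕜] 𝕜}, IsEvenOddDecomposition φ ρ ψ →
          (∑ i ∈ Finset.range t.length, ρ (monomialQSym 𝕜 (a :: t.take i)) *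
              ψ (monomialQSym 𝕜 (t.drop i)) + ψ (monomialQSym 𝕜 (a :: t)) +
              ρ (monomialQSym 𝕜 (a :: t)) = φ (monomialQSym 𝕜 (a :: t))) ∧
          (∑ i ∈ Finset.range t.length, ψ (monomialQSym 𝕜 (a :: t.take i)) *
              ((-1) ^ (t.drop i).sum * ψ (monomialQSym 𝕜 (t.drop i))) +
              (-1) ^ (a :: t).sum * ψ (monomialQSym 𝕜 (a :: t)) +
              ψ (monomialQSym 𝕜 (a :: t)) = 0) ∧
          (-1) ^ (a :: t).sum * ρ (monomialQSym 𝕜 (a :: t)) = ρ (monomialQSym 𝕜 (a :: t)) := by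
        intro ρ ψ h
        refine ⟨?_, ?_, ?_⟩
        · have e := congrArg (fun χ => χ.ofConv (monomialQSym 𝕜 (a :: t))) h.eq_conv
          simp only [conv_monomialQSym _ _ hα] at e
          rw [sum_range_take_drop_cons fun x y =>
            ρ (monomialQSym 𝕜 x) * ψ (monomialQSym 𝕜 y)] at e
          simpa [monomialQSym_nil, h.even_one, h.odd_one] using e.symm
        · have e := congrArg (fun χ => χ.ofConv (monomialQSym 𝕜 (a :: t))) h.odd.1
          simp only [conv_monomialQSym _ _ hα, convOne_monomialQSym,
            comp_qsymBar_monomialQSym] at e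
          rw [sum_range_take_drop_cons fun x y => ψ (monomialQSym 𝕜 x) *
            ((-1) ^ y.sum * ψ (monomialQSym 𝕜 y))] at e
          simpa [monomialQSym_nil, h.odd_one] using e
        · have e := congrArg (fun χ : QSym 𝕜 →ₗ[𝕜] 𝕜 => χ (monomialQSym 𝕜 (a :: t))) h.even
          simpa only [comp_qsymBar_monomialQSym] using e
      obtain ⟨e1, e2, e3⟩ := expand h
      obtain ⟨e1', e2', e3'⟩ := expand h'
      rw [Finset.sum_congr rfl fun i hi => by rw [(htake i hi).1, hdrop i]] at e1
      rw [Finset.sum_congr rfl fun i hi => by rw [(htake i hi).2, hdrop i]] at e2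
      rcases (a :: t).sum.even_or_odd with hn | hn
      · rw [hn.neg_one_pow] at e2 e2'
        have e : ψ (monomialQSym 𝕜 (a :: t)) = ψ' (monomialQSym 𝕜 (a :: t)) := by
          apply mul_left_cancel₀ h2
          linear_combination e2 - e2'
        exact ⟨by linear_combination e1 - e1' - e, e⟩
      · have zero : ∀ x : 𝕜, (-1) ^ (a :: t).sum * x = x → x = 0 := fun x hx => by
          rw [hn.neg_one_pow] at hx
          apply (mul_eq_zero.1 (_ : 2 * x = 0)).resolve_left h2
          linear_combination -hx
        have e := (zero _ e3).trans (zero _ e3').symm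
        exact ⟨e, by linear_combination e1 - e1' - e⟩
  exact ⟨qsym_hom_ext fun α hα => (key _ α rfl hα).1, qsym_hom_ext fun α hα => (key _ α rfl hα).2⟩

/-! ### The even and odd parts of the universal character -/

/-- The odd part of the universal character. -/
def zetaOdd (𝕜 : Type*) [Field 𝕜] : QSym 𝕜 →ₗ[𝕜] 𝕜 :=
  listFunctional (parityWeight (catalanDiff 𝕜 0))

/-- The even part of the universal character. -/
def zetaEven (𝕜 : Type*) [Field 𝕜] : QSym 𝕜 →ₗ[𝕜] 𝕜 :=
  (WithConv.toConv (qsymZeta 𝕜).toLinearMap *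
    WithConv.toConv (zetaOdd 𝕜 ∘ₗ qsymBar 𝕜)).ofConv

theorem zetaOdd_monomialQSym {α : List ℕ} (hα : ∀ x ∈ α, 0 < x) :
    zetaOdd 𝕜 (monomialQSym 𝕜 α) = parityWeight (catalanDiff 𝕜 0) α :=
  listFunctional_monomialQSym _ hα

theorem isOddFunctional_zetaOdd (h2 : (2 : 𝕜) ≠ 0) : IsOddFunctional (zetaOdd 𝕜) := by
  have main : ∀ α : List ℕ, ∑ i ∈ Finset.range (α.length + 1),
      parityWeight (catalanDiff 𝕜 0) (α.take i) *
        ((-1) ^ (α.drop i).sum * parityWeight (catalanDiff 𝕜 0) (α.drop i)) =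
      if α.length = 0 then 1 else 0 := fun α => by
    simp only [← parityWeight_neg_one_pow_mul]
    rw [sum_parityWeight_take_mul_drop]
    simp only [sum_catalanDiff_mul h2]
    exact parityWeight_single_zero α
  constructor
  all_goals
    apply WithConv.ofConv_injective
    apply qsym_hom_ext
    intro α hα
    have ht : ∀ i, ∀ x ∈ α.take i, 0 < x := fun i x hx => hα x (List.mem_of_mem_take hx)
    have hd : ∀ i, ∀ x ∈ α.drop i, 0 < x := fun i x hx => hα x (List.mem_of_mem_drop hx)
    simp only [conv_monomialQSym _ _ hα, convOne_monomialQSym, comp_qsymBar_monomialQSym,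
      zetaOdd_monomialQSym (ht _), zetaOdd_monomialQSym (hd _)]
  · exact main α
  -- The other one-sided inverse is the bar of the first identity: the sign `(-1)^α.sum` splits over
  -- prefix and suffix and cancels the sign of the suffix.
  · have h := congrArg ((-1 : 𝕜) ^ α.sum * ·) (main α)
    simp only [Finset.mul_sum] at h
    have hr : (-1 : 𝕜) ^ α.sum * (if α.length = 0 then 1 else 0) =
        if α.length = 0 then 1 else 0 := by
      split_ifs with h0
      · rw [List.length_eq_zero_iff.1 h0]
        simp
      · simp
    rw [hr] at h
    rw [← h]
    refine Finset.sum_congr rfl fun i _ => ?_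
    have hs : α.sum = (α.take i).sum + (α.drop i).sum := by
      rw [← List.sum_append, List.take_append_drop]
    have hsq : (-1 : 𝕜) ^ (α.drop i).sum * (-1) ^ (α.drop i).sum = 1 := by
      rw [← mul_pow]
      simp
    rw [hs, pow_add]
    linear_combination (-(-1) ^ (α.take i).sum * parityWeight (catalanDiff 𝕜 0) (α.take i) *
      parityWeight (catalanDiff 𝕜 0) (α.drop i)) * hsq

theorem zetaEven_one : zetaEven 𝕜 1 = 1 := by
  rw [← monomialQSym_nil, zetaEven, conv_monomialQSym _ _ (by simp)]
  simp only [comp_qsymBar_monomialQSym]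
  simp only [List.length_nil, zero_add, Finset.sum_range_one, List.take_nil, List.drop_nil,
    AlgHom.toLinearMap_apply, List.sum_nil, pow_zero, one_mul]
  rw [monomialQSym_nil, map_one, one_mul, ← monomialQSym_nil, zetaOdd_monomialQSym (by simp)]
  exact catalanDiff_zero_zero

/-- As `ζ` vanishes on `M_β` when `β` has at least two terms, only the prefixes `[]` and `[a]`
contribute to `ζ ζ̄₋`; the global sign is factored out. -/
theorem zetaEven_monomialQSym_cons {a : ℕ} {t : List ℕ} (hα : ∀ x ∈ a :: t, 0 < x) :
    zetaEven 𝕜 (monomialQSym 𝕜 (a :: t)) = (-1) ^ (a :: t).sum *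
      (parityWeight (catalanDiff 𝕜 0) (a :: t) + tailWeight (catalanDiff 𝕜 0) (a :: t)) := by
  rw [zetaEven, conv_monomialQSym _ _ hα, Finset.sum_range_succ', List.length_cons,
    Finset.sum_range_succ']
  have hzero : ∀ i ∈ Finset.range t.length,
      (WithConv.toConv (qsymZeta 𝕜).toLinearMap).ofConv
        (monomialQSym 𝕜 ((a :: t).take (i + 1 + 1))) *
      (WithConv.toConv (zetaOdd 𝕜 ∘ₗ qsymBar 𝕜)).ofConv
        (monomialQSym 𝕜 ((a :: t).drop (i + 1 + 1))) = 0 := fun i hi => by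
    rw [Finset.mem_range] at hi
    have hz : qsymZeta 𝕜 (monomialQSym 𝕜 ((a :: t).take (i + 1 + 1))) = 0 := by
      rw [qsymZeta_monomialQSym fun x hx => hα x (List.mem_of_mem_take hx), if_neg]
      rw [List.length_take, List.length_cons]
      omega
    exact mul_eq_zero_of_left hz _
  rw [Finset.sum_eq_zero hzero]
  have ha : ∀ x ∈ [a], 0 < x := fun x hx => hα x (by simp_all)
  have ht : ∀ x ∈ t, 0 < x := fun x hx => hα x (List.mem_cons_of_mem _ hx)
  have h1 : qsymZeta 𝕜 (monomialQSym 𝕜 [a]) = 1 := by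
    rw [qsymZeta_monomialQSym ha, if_pos (by simp)]
  have hsq : (-1 : 𝕜) ^ a * (-1) ^ a = 1 := by
    rw [← mul_pow]
    simp
  simp only [comp_qsymBar_monomialQSym, zero_add, List.take_succ_cons, List.take_zero,
    List.drop_succ_cons, List.drop_zero, AlgHom.toLinearMap_apply, h1, monomialQSym_nil, map_one,
    zetaOdd_monomialQSym hα, zetaOdd_monomialQSym ht, tailWeight, List.sum_cons, pow_add]
  linear_combination (-(-1) ^ t.sum * parityWeight (catalanDiff 𝕜 0) t) * hsq

/-- The weight evaluates `f` at the number of odd terms of `t`, which is congruent to `t.sum` modulo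
`2`; only such indices matter. -/
theorem parityWeight_shift (f : ℕ → 𝕜) (t : List ℕ)
    (hf : ∀ m, m % 2 = t.sum % 2 → f (m + 1) = f m) :
    parityWeight (fun j => f (j + 1)) t = parityWeight f t := by
  induction t generalizing f with
  | nil => exact hf 0 rfl
  | cons a t ih =>
    rw [List.sum_cons] at hf
    rcases a.even_or_odd with ha | ha
    · rw [parityWeight_cons_of_even _ ha, parityWeight_cons_of_even _ ha,
        ih f fun m hm => hf m (by rw [Nat.even_iff] at ha; omega)]
    · rw [parityWeight_cons_of_odd _ ha, parityWeight_cons_of_odd _ ha,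
        ih (fun j => f (j + 1)) fun m hm => hf (m + 1) (by rw [Nat.odd_iff] at ha; omega)]

/-- The reason why `ζ₊` is even. If `a` is even, the two summands are opposite by definition; if `a`
is odd, `t.sum` is even and `f(2m+1) = f(2m)` makes them opposite. -/
theorem parityWeight_add_tailWeight_of_odd {a : ℕ} {t : List ℕ} (hn : Odd (a :: t).sum) :
    parityWeight (catalanDiff 𝕜 0) (a :: t) + tailWeight (catalanDiff 𝕜 0) (a :: t) = 0 := by
  rw [List.sum_cons] at hn
  rw [tailWeight]
  rcases a.even_or_odd with ha | ha
  · have ht : t ≠ [] := by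
      rintro rfl
      rw [List.sum_nil, add_zero] at hn
      exact Nat.not_odd_iff_even.2 ha hn
    rw [parityWeight_cons_of_even _ ha, if_neg ht, ha.neg_one_pow]
    ring
  · rw [parityWeight_cons_of_odd _ ha, ha.neg_one_pow, parityWeight_shift]
    · ring
    · intro m hm
      have hm2 : m = 2 * (m / 2) := by
        rw [Nat.odd_iff] at ha hn
        omega
      rw [hm2, catalanDiff_odd]

theorem zetaEven_monomialQSym_of_odd {α : List ℕ} (hα : ∀ x ∈ α, 0 < x) (hn : Odd α.sum) :
    zetaEven 𝕜 (monomialQSym 𝕜 α) = 0 := by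
  cases α with
  | nil => simp at hn
  | cons a t =>
    rw [zetaEven_monomialQSym_cons hα, parityWeight_add_tailWeight_of_odd hn, mul_zero]

theorem isEvenFunctional_zetaEven : IsEvenFunctional (zetaEven 𝕜) := by
  apply qsym_hom_ext
  intro α hα
  rw [comp_qsymBar_monomialQSym]
  rcases α.sum.even_or_odd with hn | hn
  · rw [hn.neg_one_pow, one_mul]
  · rw [zetaEven_monomialQSym_of_odd hα hn, mul_zero]

theorem isEvenOddDecomposition_qsymZeta (h2 : (2 : 𝕜) ≠ 0) :
    IsEvenOddDecomposition (qsymZeta 𝕜).toLinearMap (zetaEven 𝕜) (zetaOdd 𝕜) where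
  even_one := zetaEven_one
  odd_one := by
    rw [← monomialQSym_nil, zetaOdd_monomialQSym (by simp)]
    exact catalanDiff_zero_zero
  even := isEvenFunctional_zetaEven
  odd := isOddFunctional_zetaOdd h2
  eq_conv := by
    have h : WithConv.toConv (zetaEven 𝕜) = WithConv.toConv (qsymZeta 𝕜).toLinearMap *
      WithConv.toConv (zetaOdd 𝕜 ∘ₗ qsymBar 𝕜) := rfl
    rw [h, mul_assoc, (isOddFunctional_zetaOdd h2).2, mul_one]

/-! ### Values on the fundamental basis -/

theorem catalanDiff_eq_div (p n : ℕ) (hp : p ≤ n / 2) {q : ℕ} (hq : q / 2 = n / 2 - p) :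
    catalanDiff 𝕜 p q =
      (-1) ^ p / 2 ^ (2 * (n / 2)) * (bivariateCatalan p (n / 2 - p) : 𝕜) := by
  rw [catalanDiff, hq, pow_mul, show p + (n / 2 - p) = n / 2 by omega]
  norm_num
  ring

theorem interiorPeaks_le_half {n : ℕ} (α : Composition n) : interiorPeaks α ≤ n / 2 := by
  have h := (two_mul_listPeaks_le fun _ hx => α.blocks_pos hx).1
  rw [interiorPeaks_eq_listPeaks]
  rw [α.blocks_sum] at h
  omega

theorem zetaOdd_qsymF (h2 : (2 : 𝕜) ≠ 0) {n : ℕ} (α : Composition n) :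
    zetaOdd 𝕜 (qsymF 𝕜 α) = (-1) ^ interiorPeaks α / 2 ^ (2 * (n / 2)) *
      (bivariateCatalan (interiorPeaks α) (n / 2 - interiorPeaks α) : 𝕜) := by
  have hp := interiorPeaks_le_half α
  obtain ⟨r, hr⟩ := Nat.exists_eq_add_of_le
    (two_mul_listPeaks_le fun _ hx => α.blocks_pos hx).1
  rw [qsymF_eq_sum α _ _ fun β hβ => zetaOdd_monomialQSym hβ,
    show catalanDiff 𝕜 0 = fun j => catalanDiff 𝕜 0 (j + 0) from rfl,
    sum_parityWeight_catalanDiff h2 (fun _ hx => α.blocks_pos hx) 0 0 r hr.symm, zero_add, zero_add,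
    ← interiorPeaks_eq_listPeaks, catalanDiff_eq_div _ n hp]
  rw [α.blocks_sum, ← interiorPeaks_eq_listPeaks] at hr
  omega

theorem zetaEven_qsymF_of_odd {n : ℕ} (hn : Odd n) (α : Composition n) :
    zetaEven 𝕜 (qsymF 𝕜 α) = 0 := by
  rw [qsymF, map_sum]
  exact Finset.sum_eq_zero fun β _ => zetaEven_monomialQSym_of_odd (fun _ hx => β.blocks_pos hx)
    (by rwa [β.blocks_sum])

theorem zetaEven_qsymF_of_even (h2 : (2 : 𝕜) ≠ 0) {n : ℕ} (hn : Even n) (α : Composition n) :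
    augmentedPeaks α ≤ n / 2 ∧ zetaEven 𝕜 (qsymF 𝕜 α) = (-1) ^ augmentedPeaks α / 2 ^ n *
      (bivariateCatalan (augmentedPeaks α) (n / 2 - augmentedPeaks α) : 𝕜) := by
  have hpos : ∀ x ∈ α.blocks, 0 < x := fun _ hx => α.blocks_pos hx
  have hsum := α.blocks_sum
  have hn2 : 2 * (n / 2) = n := Nat.mul_div_cancel' hn.two_dvd
  match hb : α.blocks with
  | [] =>
    obtain rfl : n = 0 := by simpa [hb] using hsum.symm
    have hp : augmentedPeaks α = 0 := by
      rw [augmentedPeaks, if_neg]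
      rw [Composition.length, hb]
      simp
    have hF : qsymF 𝕜 α = 1 := by
      rw [← monomialQSym_nil, ← sum_refinements_nil (monomialQSym 𝕜), ← hb]
      exact sum_boundaries_subset α (monomialQSym 𝕜)
    rw [hp, hF, zetaEven_one]
    simp [bivariateCatalan]
  | 0 :: t => exact absurd (hpos 0 (by simp [hb])) (lt_irrefl _)
  | (a + 1) :: t =>
    rw [hb] at hpos hsum
    have ht : ∀ x ∈ t, 0 < x := fun x hx => hpos x (List.mem_cons_of_mem _ hx)
    have hF : zetaEven 𝕜 (qsymF 𝕜 α) = ∑ β ∈ refinements ((a + 1) :: t),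
        (parityWeight (catalanDiff 𝕜 0) β + tailWeight (catalanDiff 𝕜 0) β) := by
      rw [qsymF, map_sum, ← hb, ← sum_boundaries_subset]
      refine Finset.sum_congr rfl fun β hβ => ?_
      have hmem := (boundaries_subset_iff α β).1 (Finset.mem_filter.1 hβ).2
      rw [hb] at hmem
      obtain ⟨b, s, hs⟩ := exists_cons_of_mem_refinements hmem
      have hβpos : ∀ x ∈ β.blocks, 0 < x := fun _ hx => β.blocks_pos hx
      have hβsum := β.blocks_sum
      rw [qsymM]
      rw [hs] at hβpos hβsum ⊢
      rw [zetaEven_monomialQSym_cons hβpos, hβsum, hn.neg_one_pow, one_mul]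
    have hp := augmentedPeaks_eq_listPeaks α hb
    rw [List.sum_cons] at hsum
    rw [hF]
    by_cases h0 : t = []
    · rw [if_pos h0] at hp
      subst h0
      rw [List.sum_nil, add_zero] at hsum
      -- The only term `a + 1` is the even number `n`, so the sum of the tail weights vanishes.
      obtain ⟨m, rfl⟩ : ∃ m, a = 2 * m + 1 := ⟨n / 2 - 1, by omega⟩
      rw [hp, Finset.sum_add_distrib, sum_tailWeight_singleton _ (catalanDiff_odd 0),
        sum_parityWeight_singleton, catalanDiff_eq_div 0 n (Nat.zero_le _) (by omega),
        hn2, add_zero]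
      exact ⟨Nat.zero_le _, rfl⟩
    · rw [if_neg h0] at hp
      have hlt := (two_mul_listPeaks_le ht).2 h0
      have hle : 1 + listPeaks t ≤ n / 2 := by omega
      obtain ⟨k, hk⟩ := Nat.exists_eq_add_of_le hle
      rw [hp, sum_parityWeight_add_tailWeight_catalanDiff h2 h0 ht k (by omega),
        catalanDiff_eq_div _ n hle (by omega), hn2]
      exact ⟨hle, rfl⟩

end

end

theorem theoremT {𝕜 : Type*} [Field 𝕜] (h2 : ringChar 𝕜 ≠ 2) :
    ∃ zetaPlus zetaMinus : QSym 𝕜 →ₗ[𝕜] 𝕜,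
      IsEvenOddDecomposition (qsymZeta 𝕜).toLinearMap zetaPlus zetaMinus ∧
      (∀ ρ ψ : QSym 𝕜 →ₗ[𝕜] 𝕜,
        IsEvenOddDecomposition (qsymZeta 𝕜).toLinearMap ρ ψ → ρ = zetaPlus ∧ ψ = zetaMinus) ∧
      ∀ (n : ℕ) (α : Composition n),
        (interiorPeaks α ≤ n / 2 ∧
          zetaMinus (qsymF 𝕜 α) = (-1) ^ interiorPeaks α / 2 ^ (2 * (n / 2)) *
            (bivariateCatalan (interiorPeaks α) (n / 2 - interiorPeaks α) : 𝕜)) ∧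
        (Even n → augmentedPeaks α ≤ n / 2 ∧
          zetaPlus (qsymF 𝕜 α) = (-1) ^ augmentedPeaks α / 2 ^ n *
            (bivariateCatalan (augmentedPeaks α) (n / 2 - augmentedPeaks α) : 𝕜)) ∧
        (Odd n → zetaPlus (qsymF 𝕜 α) = 0) := by
  have h : (2 : 𝕜) ≠ 0 := Ring.two_ne_zero h2
  have hdec := isEvenOddDecomposition_qsymZeta h
  refine ⟨zetaEven 𝕜, zetaOdd 𝕜, hdec, fun ρ ψ hρψ => hρψ.unique h hdec,
    fun n α => ⟨⟨?_, ?_⟩, ?_, ?_⟩⟩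
  · exact interiorPeaks_le_half α
  · exact zetaOdd_qsymF h α
  · exact fun hn => zetaEven_qsymF_of_even h hn α
  · exact fun hn => zetaEven_qsymF_of_odd hn α
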